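/- Fix real numbers $0<\theta<1$ and $\varkappa>0$ and an integer $q\ge 1$. For $T>1$ put $\xi=T^{\varkappa}$ and, for $x\ge 1$, $$\mathcal M(x)=\mathcal M(\xi,x)=\frac1{\log\xi}\begin{cases}\log\xi & 1\le x\le \xi^{\theta},\\ \frac1{1-\theta}\log(\xi/x) & \xi^{\theta}<x\le\xi,\\ 0& x>\xi.\end{cases}$$ For real $z$ let $\tau_z(n)$ be the coefficients of the Dirichlet series $\zeta(s)^z=\sum_n\tau_z(n)n^{-s}$, let $\phi$ be Euler's function, and for integers $a,b\ge1$ write $a\mid b^\infty$ if every prime dividing $a$ divides $b$. Put $$\mathfrak C_4=\frac{1}{3(1-\theta)\sqrt\pi}\left[\frac{9(1+\theta^{5/2})}{5}+2\max\Bigl\{3\sqrt{1-\theta},\ \min\bigl\{\max\{1,|1-4\theta|\}+3\theta\sqrt\theta,\ 1-\theta+3\theta\sqrt{1-\theta}\bigr\}\Bigr\}\right].$$ Then there are a constant $C$ and a function $\omega(T)$ with $\omega(T)\to0$ as $T\to\infty$, both depending only on $\theta,\varkappa,q$, such that for all sufficiently large $T$ (in terms of $\theta,\varkappa,q$), for all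 integers $d\ge1$ coprime to $q$, all integers $1\le\delta\le\xi$ with $\delta\mid d^\infty$, and all real $0<v\le 1/\log\xi$, $$\left|\sum_{\substack{n\ge1\\(n,qd)=1}}\frac{\mathcal M(n\delta)\,\tau_{-1/2}(n\delta)}{n}\,\frac{\sin(v\log(n\delta))}{v}\right|\le (1+\omega(T))\,\mathfrak C_4\,\tau_{1/2}(\delta)\sqrt{\frac{dq}{\phi(d)\phi(q)}}\,(\log\xi)^{1/2}+C\,\tau_{1/2}(\delta)\prod_{p\mid d}\bigl(1+p^{-3/4}\bigr)(\log T)^{1/3}.$$ -/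

import Mathlib

open Filter Topology

/-- The value at a prime power `p ^ k` of the generalized divisor function `τ_z`:
the coefficient `z (z + 1) ⋯ (z + k - 1) / k!` of `X ^ k` in `(1 - X) ^ (-z)`. -/
noncomputable def divisorTauCoeff (z : ℝ) (k : ℕ) : ℝ :=
  ∏ j ∈ Finset.range k, (z + j) / (j + 1)

/-- The generalized divisor function `τ_z`, i.e. the `n`-th coefficient of the Dirichlet series
of `ζ ^ z`. From `ζ(s) ^ z = ∏ p, (1 - p ^ (-s)) ^ (-z)` it is the product, over the exact prime
powers `p ^ k` dividing `n`, of the coefficient of `X ^ k` in `(1 - X) ^ (-z)`. See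
`hasSum_divisorTau` for the identity with `ζ ^ z`. -/
noncomputable def divisorTau (z : ℝ) (n : ℕ) : ℝ :=
  n.factorization.prod fun _ k => divisorTauCoeff z k

/-- `a ∣ b ^ ∞`: every prime dividing `a` divides `b`. -/
def DvdInfty (a b : ℕ) : Prop :=
  ∀ p : ℕ, p.Prime → p ∣ a → p ∣ b

/-- The smoothing weight `𝓜(ξ, x)` with parameter `θ` (used for `x ≥ 1`, `ξ > 1`, `0 < θ < 1`). -/
noncomputable def mollWeight (θ ξ x : ℝ) : ℝ :=
  (1 / Real.log ξ) *
    (if x ≤ ξ ^ θ then Real.log ξ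
     else if x ≤ ξ then 1 / (1 - θ) * Real.log (ξ / x)
     else 0)

/-- The `n`-th term (`n ≥ 1`, `(n, qd) = 1`) of the mollified sine sum. -/
noncomputable def sineSumTerm (θ ξ : ℝ) (q d δ : ℕ) (v : ℝ) (n : ℕ) : ℝ :=
  if 1 ≤ n ∧ Nat.Coprime n (q * d) then
    mollWeight θ ξ ((n * δ : ℕ) : ℝ) * divisorTau (-1 / 2) (n * δ) / (n : ℝ)
      * (Real.sin (v * Real.log ((n * δ : ℕ) : ℝ)) / v)
  else 0

/-- `∑_{(n, qd) = 1} 𝓜(nδ) τ_{-1/2}(nδ) / n * sin (v log (nδ)) / v`, a sum over all positive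
integers `n` coprime to `qd` which has only finitely many nonzero terms
(`sineSumTerm_summable`). -/
noncomputable def sineSum (θ ξ : ℝ) (q d δ : ℕ) (v : ℝ) : ℝ :=
  ∑' n : ℕ, sineSumTerm θ ξ q d δ v n

/-- The constant `𝔆₄` as a function of `θ`. -/
noncomputable def constC4 (θ : ℝ) : ℝ :=
  1 / (3 * (1 - θ) * √Real.pi) *
    (9 * (1 + θ ^ (5 / 2 : ℝ)) / 5 +
      2 * max (3 * √(1 - θ))
        (min (max 1 |1 - 4 * θ| + 3 * θ * √θ) (1 - θ + 3 * θ * √(1 - θ))))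

theorem sineSumTerm_eq_zero {θ ξ : ℝ} (hθ1 : θ < 1) (hξ : 1 < ξ)
    {q d δ : ℕ} (hδ : 1 ≤ δ) (v : ℝ) {n : ℕ} (hn : ξ < n) : sineSumTerm θ ξ q d δ v n = 0 := by
  have h1 : ξ < ((n * δ : ℕ) : ℝ) := by
    refine hn.trans_le ?_
    exact_mod_cast Nat.le_mul_of_pos_right n hδ
  have h2 : ξ ^ θ < ((n * δ : ℕ) : ℝ) := by
    refine lt_of_le_of_lt ?_ h1
    calc ξ ^ θ ≤ ξ ^ (1 : ℝ) := Real.rpow_le_rpow_of_exponent_le hξ.le hθ1.le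
      _ = ξ := Real.rpow_one ξ
  have h3 : mollWeight θ ξ ((n * δ : ℕ) : ℝ) = 0 := by
    unfold mollWeight
    rw [if_neg (not_le.mpr h2), if_neg (not_le.mpr h1), mul_zero]
  unfold sineSumTerm
  rw [h3]
  simp

theorem sineSumTerm_summable {θ ξ : ℝ} (hθ1 : θ < 1) (hξ : 1 < ξ)
    {q d δ : ℕ} (hδ : 1 ≤ δ) (v : ℝ) : Summable (sineSumTerm θ ξ q d δ v) := by
  refine summable_of_ne_finset_zero (s := Finset.range (⌊ξ⌋₊ + 1)) fun n hn => ?_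
  refine sineSumTerm_eq_zero hθ1 hξ hδ v ?_
  rw [Finset.mem_range, not_lt] at hn
  exact Nat.lt_of_floor_lt (by omega)

theorem abs_divisorTauCoeff_le_one {z : ℝ} (hz : |z| ≤ 1) (k : ℕ) :
    |divisorTauCoeff z k| ≤ 1 := by
  unfold divisorTauCoeff
  rw [Finset.abs_prod]
  refine Finset.prod_le_one (fun _ _ => abs_nonneg _) fun j _ => ?_
  have hj : (0 : ℝ) < (j : ℝ) + 1 := by positivity
  rw [abs_div, abs_of_pos hj, div_le_one hj]
  calc |z + j| ≤ |z| + |(j : ℝ)| := abs_add_le _ _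
    _ ≤ j + 1 := by rw [abs_of_nonneg (Nat.cast_nonneg j : (0 : ℝ) ≤ (j : ℝ))]; linarith

theorem abs_divisorTau_le_one {z : ℝ} (hz : |z| ≤ 1) (n : ℕ) : |divisorTau z n| ≤ 1 := by
  unfold divisorTau Finsupp.prod
  rw [Finset.abs_prod]
  exact Finset.prod_le_one (fun _ _ => abs_nonneg _) fun j _ => abs_divisorTauCoeff_le_one hz _

theorem divisorTau_mul (z : ℝ) {m n : ℕ} (h : m.Coprime n) :
    divisorTau z (m * n) = divisorTau z m * divisorTau z n := by
  unfold divisorTau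
  rw [Nat.factorization_mul_of_coprime h]
  exact Finsupp.prod_add_index_of_disjoint (by simpa using h.disjoint_primeFactors) _

theorem divisorTau_prime_pow (z : ℝ) {p : ℕ} (hp : p.Prime) (k : ℕ) :
    divisorTau z (p ^ k) = divisorTauCoeff z k := by
  unfold divisorTau
  rw [hp.factorization_pow, Finsupp.prod_single_index]
  simp [divisorTauCoeff]

theorem divisorTauCoeff_eq (z : ℝ) (k : ℕ) :
    divisorTauCoeff z k = (-1) ^ k * Ring.choose (-z) k := by
  have h := Ring.descPochhammer_eq_factorial_smul_choose (-z) k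
  have h0 : ((k.factorial : ℕ) : ℝ) ≠ 0 := by exact_mod_cast k.factorial_ne_zero
  rw [nsmul_eq_mul] at h
  have h2 : ∀ k : ℕ, (k.factorial : ℝ) * divisorTauCoeff z k
      = (-1) ^ k * (descPochhammer ℤ k).smeval (-z) := by
    intro k
    induction k with
    | zero => simp [divisorTauCoeff]
    | succ k ih =>
      have h3 : divisorTauCoeff z (k + 1) = divisorTauCoeff z k * ((z + k) / (k + 1)) := by
        simp only [divisorTauCoeff, Finset.prod_range_succ]
      rw [h3, descPochhammer_succ_right, Polynomial.smeval_mul, Nat.factorial_succ]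
      have : ((k : ℝ) + 1) ≠ 0 := by positivity
      simp only [Polynomial.smeval_sub, Polynomial.smeval_X, Polynomial.smeval_natCast, pow_one,
        pow_zero, nsmul_eq_mul, mul_one]
      push_cast
      field_simp
      rw [pow_succ]
      linear_combination (z + k) * ih
  have h3 := h2 k
  rw [h] at h3
  apply mul_left_cancel₀ h0
  linear_combination h3

theorem hasSum_divisorTauCoeff (z : ℝ) {x : ℝ} (hx0 : 0 ≤ x) (hx : x < 1) :
    HasSum (fun k => divisorTauCoeff z k * x ^ k) ((1 - x) ^ (-z)) := by
  have h := (Real.one_add_rpow_hasFPowerSeriesOnBall_zero (a := -z)).hasSum (y := -x) (by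
    simp [abs_of_nonneg hx0, hx, enorm_eq_nnnorm, ← NNReal.coe_lt_coe])
  simp only [zero_add] at h
  have h1 : (fun k => divisorTauCoeff z k * x ^ k)
      = fun k => (binomialSeries ℝ (-z) k) fun _ => -x := by
    ext k
    rw [divisorTauCoeff_eq, binomialSeries_apply, List.ofFn_const, List.prod_replicate,
      smul_eq_mul, neg_pow x]
    ring
  rw [h1, sub_eq_add_neg]
  exact h

/-- `τ_z` is the coefficient sequence of the Dirichlet series of `ζ ^ z`. -/
theorem hasSum_divisorTau {z : ℝ} (hz : |z| ≤ 1) {s : ℝ} (hs : 1 < s) :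
    HasSum (fun n : ℕ => divisorTau z n * (n : ℝ) ^ (-s)) ((∑' n : ℕ, (n : ℝ) ^ (-s)) ^ z) := by
  have key : ∀ w : ℝ, |w| ≤ 1 →
      Summable (fun n : ℕ => divisorTau w n * (n : ℝ) ^ (-s)) ∧
      HasProd (fun p : Nat.Primes => (1 - (p : ℝ) ^ (-s)) ^ (-w))
        (∑' n : ℕ, divisorTau w n * (n : ℝ) ^ (-s)) := by
    intro w hw
    have hsum : Summable (fun n : ℕ => ‖divisorTau w n * (n : ℝ) ^ (-s)‖) := by
      refine Summable.of_nonneg_of_le (fun _ => norm_nonneg _) (fun n => ?_)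
        (Real.summable_nat_rpow.mpr (by linarith : -s < -1))
      have hn : (0 : ℝ) ≤ (n : ℝ) ^ (-s) := by positivity
      rw [norm_mul, Real.norm_eq_abs, Real.norm_of_nonneg hn]
      exact mul_le_of_le_one_left hn (abs_divisorTau_le_one hw n)
    refine ⟨hsum.of_norm, ?_⟩
    have eulerFactor : ∀ p : Nat.Primes, (1 - (p : ℝ) ^ (-s)) ^ (-w) =
        ∑' k : ℕ, divisorTau w ((p : ℕ) ^ k) * (((p : ℕ) ^ k : ℕ) : ℝ) ^ (-s) := by
      intro p
      have hp : (1 : ℝ) < (p : ℕ) := by exact_mod_cast p.2.one_lt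
      have h1 : ((p : ℕ) : ℝ) ^ (-s) < 1 := Real.rpow_lt_one_of_one_lt_of_neg hp (by linarith)
      have h2 := (hasSum_divisorTauCoeff w (by positivity : (0 : ℝ) ≤ ((p : ℕ) : ℝ) ^ (-s)) h1)
      rw [← h2.tsum_eq]
      refine tsum_congr fun k => ?_
      rw [divisorTau_prime_pow w p.2, Nat.cast_pow, ← Real.rpow_natCast, ← Real.rpow_natCast,
        ← Real.rpow_mul (by positivity), ← Real.rpow_mul (by positivity), mul_comm (-s)]
    have h := EulerProduct.eulerProduct_hasProd
      (f := fun n : ℕ => divisorTau w n * (n : ℝ) ^ (-s))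
      (by simp [divisorTau]) (fun {m n} hmn => by
        simp only [divisorTau_mul w hmn, Nat.cast_mul]
        rw [Real.mul_rpow (Nat.cast_nonneg m) (Nat.cast_nonneg n)]
        ring) hsum (by
          have : -s ≠ 0 := by linarith
          simp [Real.zero_rpow this])
    have e : (fun p : Nat.Primes => (1 - (p : ℝ) ^ (-s)) ^ (-w)) = fun p : Nat.Primes =>
        ∑' k : ℕ, divisorTau w ((p : ℕ) ^ k) * (((p : ℕ) ^ k : ℕ) : ℝ) ^ (-s) := by
      funext p
      exact eulerFactor p
    rw [e]
    exact h
  have hone : ∀ n : ℕ, divisorTau 1 n = 1 := fun n => by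
    unfold divisorTau Finsupp.prod divisorTauCoeff
    refine Finset.prod_eq_one fun p _ => Finset.prod_eq_one fun j _ => ?_
    rw [add_comm]
    exact div_self (by positivity)
  obtain ⟨-, hP⟩ := key 1 (by simp)
  simp only [hone, one_mul] at hP
  obtain ⟨hS, hQ⟩ := key z hz
  have hZ : (∑' n : ℕ, (n : ℝ) ^ (-s)) ≠ 0 := by
    have := (Real.summable_nat_rpow.mpr (by linarith : -s < -1)).tsum_pos
      (fun n => by positivity) 1 (by simp)
    exact this.ne'
  have hP' : HasProd (fun p : Nat.Primes => (1 - (p : ℝ) ^ (-s)) ^ (-z))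
      ((∑' n : ℕ, (n : ℝ) ^ (-s)) ^ z) := by
    have h := (Real.continuousAt_rpow_const _ z (Or.inl hZ)).tendsto.comp hP
    refine Tendsto.congr (fun S => ?_) h
    have hpos : ∀ p : Nat.Primes, (0 : ℝ) ≤ 1 - ((p : ℕ) : ℝ) ^ (-s) := fun p => by
      have hp : (1 : ℝ) < (p : ℕ) := by exact_mod_cast p.2.one_lt
      have := Real.rpow_lt_one_of_one_lt_of_neg hp (by linarith : -s < 0)
      linarith
    simp only [Function.comp]
    rw [← Real.finsetProd_rpow _ _ (fun p _ => Real.rpow_nonneg (hpos p) _)]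
    refine Finset.prod_congr rfl fun p _ => ?_
    rw [← Real.rpow_mul (hpos p)]
    congr 1
    ring
  rw [← hQ.unique hP']
  exact hS.hasSum

/-! ### Convolution identities for τ_z. -/

theorem sum_Ioc_sum_divisorsAntidiagonal (F : ℕ → ℕ → ℝ) (N : ℕ) :
    ∑ n ∈ Finset.Ioc 0 N, ∑ x ∈ n.divisorsAntidiagonal, F x.1 x.2 =
      ∑ a ∈ Finset.Ioc 0 N, ∑ b ∈ Finset.Ioc 0 (N / a), F a b := by
  rw [Finset.sum_sigma', Finset.sum_sigma']
  refine Finset.sum_bij' (fun x _ => ⟨x.2.1, x.2.2⟩) (fun y _ => ⟨y.1 * y.2, (y.1, y.2)⟩)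
    ?_ ?_ ?_ ?_ ?_
  · rintro ⟨n, a, b⟩ h
    simp only [Finset.mem_sigma, Finset.mem_Ioc, Nat.mem_divisorsAntidiagonal] at h ⊢
    obtain ⟨⟨h1, h2⟩, rfl, h3⟩ := h
    have ha : 0 < a := Nat.pos_of_ne_zero (left_ne_zero_of_mul h3)
    have hb : 0 < b := Nat.pos_of_ne_zero (right_ne_zero_of_mul h3)
    refine ⟨⟨ha, (Nat.le_mul_of_pos_right a hb).trans h2⟩, hb, ?_⟩
    rw [Nat.le_div_iff_mul_le ha, mul_comm]
    exact h2
  · rintro ⟨a, b⟩ h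
    simp only [Finset.mem_sigma, Finset.mem_Ioc, Nat.mem_divisorsAntidiagonal] at h ⊢
    obtain ⟨⟨h1, h2⟩, h3, h4⟩ := h
    rw [Nat.le_div_iff_mul_le h1, mul_comm] at h4
    exact ⟨⟨Nat.mul_pos h1 h3, h4⟩, trivial, (Nat.mul_pos h1 h3).ne'⟩
  · rintro ⟨n, a, b⟩ h
    simp only [Finset.mem_sigma, Finset.mem_Ioc, Nat.mem_divisorsAntidiagonal] at h
    obtain ⟨-, rfl, -⟩ := h
    rfl
  · rintro ⟨a, b⟩ h
    rfl
  · rintro ⟨n, a, b⟩ h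
    rfl

theorem divisorTauCoeff_succ (z : ℝ) (k : ℕ) :
    divisorTauCoeff z (k + 1) = divisorTauCoeff z k * ((z + k) / (k + 1)) := by
  simp only [divisorTauCoeff, Finset.prod_range_succ]

/-- Coefficient form of X f' = z X (1 - X)⁻¹ f for f = (1 - X)^(-z). -/
theorem mul_divisorTauCoeff (z : ℝ) (k : ℕ) :
    k * divisorTauCoeff z k = z * ∑ j ∈ Finset.range k, divisorTauCoeff z j := by
  induction k with
  | zero => simp
  | succ k ih =>
    rw [Finset.sum_range_succ, mul_add, ← ih, divisorTauCoeff_succ]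
    push_cast
    field_simp
    ring

open ArithmeticFunction in
/-- The logarithmic derivative of `ζ ^ z` in terms of coefficients. -/
theorem divisorTau_mul_log (z : ℝ) (n : ℕ) (hn : n ≠ 0) :
    divisorTau z n * Real.log n =
      z * ∑ i ∈ n.divisors, vonMangoldt i * divisorTau z (n / i) := by
  revert hn
  refine Nat.recOnPrimeCoprime ?_ ?_ ?_ n
  · simp
  · intro p k hp _
    rw [Nat.sum_divisors_prime_pow hp, Nat.cast_pow, Real.log_pow, Finset.sum_range_succ',
      pow_zero, vonMangoldt_apply_one, zero_mul, add_zero, divisorTau_prime_pow z hp]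
    have h1 : ∀ j ∈ Finset.range k, vonMangoldt (p ^ (j + 1)) * divisorTau z (p ^ k / p ^ (j + 1))
        = Real.log p * divisorTauCoeff z (k - 1 - j) := by
      intro j hj
      rw [Finset.mem_range] at hj
      rw [vonMangoldt_apply_pow j.succ_ne_zero, vonMangoldt_apply_prime hp,
        Nat.pow_div (by omega) hp.pos, divisorTau_prime_pow z hp]
      congr 2
      omega
    rw [Finset.sum_congr rfl h1, ← Finset.mul_sum,
      Finset.sum_range_reflect (fun j => divisorTauCoeff z j) k]
    linear_combination Real.log p * mul_divisorTauCoeff z k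
  · intro a b ha hb hab iha ihb _
    have iha := iha (by omega)
    have ihb := ihb (by omega)
    -- Λ lives on prime powers, and a prime power dividing ab with a, b coprime divides exactly one
    -- of them; hence the divisor sum splits like a derivation.
    have key : ∀ m : ℕ, ∀ g : ℕ → ℝ, ∑ i ∈ m.divisors, vonMangoldt i * g i =
        ∑ i ∈ m.divisors with IsPrimePow i, Real.log i.minFac * g i := by
      intro m g
      rw [Finset.sum_filter]
      refine Finset.sum_congr rfl fun i _ => ?_
      rw [vonMangoldt_apply]
      split_ifs <;> simp
    have h1 : ∑ i ∈ (a * b).divisors, vonMangoldt i * divisorTau z (a * b / i) =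
        (∑ i ∈ a.divisors, vonMangoldt i * divisorTau z (a / i)) * divisorTau z b +
        divisorTau z a * ∑ i ∈ b.divisors, vonMangoldt i * divisorTau z (b / i) := by
      rw [key, Nat.mul_divisors_filter_prime_pow hab, Finset.filter_union,
        Finset.sum_union (Nat.disjoint_divisors_filter_isPrimePow hab),
        ← key a (fun i => divisorTau z (a * b / i)), ← key b (fun i => divisorTau z (a * b / i)),
        Finset.sum_mul, Finset.mul_sum]
      congr 1
      · refine Finset.sum_congr rfl fun i hi => ?_
        have hi := Nat.dvd_of_mem_divisors hi
        rw [← Nat.div_mul_right_comm hi,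
          divisorTau_mul z (hab.coprime_dvd_left (Nat.div_dvd_of_dvd hi)), mul_assoc]
      · refine Finset.sum_congr rfl fun i hi => ?_
        have hi := Nat.dvd_of_mem_divisors hi
        rw [Nat.mul_div_assoc a hi, divisorTau_mul z (hab.coprime_dvd_right (Nat.div_dvd_of_dvd hi))]
        ring
    rw [h1, divisorTau_mul z hab, Nat.cast_mul, Real.log_mul (by positivity) (by positivity)]
    linear_combination divisorTau z b * iha + divisorTau z a * ihb

theorem divisorTauCoeff_nonneg {z : ℝ} (hz : 0 ≤ z) (k : ℕ) : 0 ≤ divisorTauCoeff z k :=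
  Finset.prod_nonneg fun _ _ => by positivity

theorem divisorTau_nonneg {z : ℝ} (hz : 0 ≤ z) (n : ℕ) : 0 ≤ divisorTau z n := by
  unfold divisorTau Finsupp.prod
  exact Finset.prod_nonneg fun _ _ => divisorTauCoeff_nonneg hz _

theorem abs_divisorTauCoeff_le (z : ℝ) (k : ℕ) :
    |divisorTauCoeff z k| ≤ divisorTauCoeff |z| k := by
  unfold divisorTauCoeff
  rw [Finset.abs_prod]
  refine Finset.prod_le_prod (fun _ _ => abs_nonneg _) fun j _ => ?_
  have hj : (0 : ℝ) < (j : ℝ) + 1 := by positivity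
  rw [abs_div, abs_of_pos hj]
  gcongr
  exact (abs_add_le _ _).trans_eq (by simp)

theorem abs_divisorTau_le (z : ℝ) (n : ℕ) : |divisorTau z n| ≤ divisorTau |z| n := by
  unfold divisorTau Finsupp.prod
  rw [Finset.abs_prod]
  exact Finset.prod_le_prod (fun _ _ => abs_nonneg _) fun j _ => abs_divisorTauCoeff_le _ _

theorem abs_divisorTau_neg_half_le (n : ℕ) :
    |divisorTau (-1 / 2) n| ≤ divisorTau (1 / 2) n := by
  refine (abs_divisorTau_le _ n).trans_eq ?_
  congr 1
  rw [abs_of_neg] <;> norm_num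

/-- The coefficients of `(1 - X) ^ (-z)` and `(1 - X) ^ z` are convolution inverses. -/
theorem sum_divisorTauCoeff_mul (z : ℝ) (v : ℕ) :
    ∑ k ∈ Finset.range (v + 1), divisorTauCoeff z k * divisorTauCoeff (-z) (v - k) =
      if v = 0 then 1 else 0 := by
  have h := Ring.add_choose_eq (r := -z) (s := z) v (Commute.all _ _)
  rw [neg_add_cancel] at h
  rw [Finset.Nat.sum_antidiagonal_eq_sum_range_succ_mk] at h
  have h2 : ∑ k ∈ Finset.range (v + 1), divisorTauCoeff z k * divisorTauCoeff (-z) (v - k)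
      = (-1) ^ v * ∑ k ∈ Finset.range (v + 1), Ring.choose (-z) k * Ring.choose z (v - k) := by
    rw [Finset.mul_sum]
    refine Finset.sum_congr rfl fun k hk => ?_
    rw [Finset.mem_range] at hk
    rw [divisorTauCoeff_eq, divisorTauCoeff_eq, neg_neg]
    have : (-1 : ℝ) ^ v = (-1) ^ k * (-1) ^ (v - k) := by
      rw [← pow_add]; congr 1; omega
    rw [this]; ring
  rw [h2, ← h]
  rcases eq_or_ne v 0 with rfl | hv
  · simp
  · rw [Ring.choose_zero_pos _ (Nat.pos_of_ne_zero hv), if_neg hv, mul_zero]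

/-! ### Rankin's bound for the absolute values. -/

theorem tendsto_mul_tsum_rpow_neg :
    Tendsto (fun s : ℝ => s * ∑' n : ℕ, (n : ℝ) ^ (-(1 + s))) (𝓝[>] 0) (𝓝 1) := by
  have h : Tendsto (fun s : ℝ => 1 + s) (𝓝[>] 0) (𝓝[>] 1) := by
    refine tendsto_nhdsWithin_iff.mpr ⟨?_, ?_⟩
    · have : Tendsto (fun s : ℝ => 1 + s) (𝓝 0) (𝓝 (1 + 0)) := tendsto_const_nhds.add tendsto_id
      rw [add_zero] at this
      exact this.mono_left nhdsWithin_le_nhds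
    · filter_upwards [self_mem_nhdsWithin] with s hs
      have : (0 : ℝ) < s := hs
      simp [this]
  refine (tendsto_sub_mul_tsum_nat_rpow.comp h).congr fun s => ?_
  simp only [Function.comp, add_sub_cancel_left]
  congr 1
  exact tsum_congr fun n => by rw [Real.rpow_neg (Nat.cast_nonneg n), one_div]

/-- Rankin's trick: for n ≤ e^(1/s) one has 1 ≤ e · n^(-s), so the sum is at most e · ζ(1+s)^(1/2),
and ζ(1+s) < 4/s for small s. Taking s of size 1/l gives √l. -/
theorem sum_divisorTau_half_div_le :
    ∃ K : ℝ, 0 < K ∧ ∀ l : ℝ, 0 ≤ l → ∀ N : ℕ, (N : ℝ) ≤ Real.exp l →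
      ∑ n ∈ Finset.Ioc 0 N, divisorTau (1 / 2) n / n ≤ K * √(1 + l) := by
  have h1 : ∀ᶠ s : ℝ in 𝓝[>] 0, s * ∑' n : ℕ, (n : ℝ) ^ (-(1 + s)) < 4 :=
    tendsto_mul_tsum_rpow_neg.eventually_lt_const (by norm_num)
  rw [eventually_nhdsWithin_iff, Metric.eventually_nhds_iff] at h1
  obtain ⟨ε, hε, h1⟩ := h1
  have main : ∀ s : ℝ, 0 < s → s < ε → ∀ N : ℕ, (N : ℝ) ≤ Real.exp (1 / s) →
      ∑ n ∈ Finset.Ioc 0 N, divisorTau (1 / 2) n / n ≤ Real.exp 1 * 2 * √(1 / s) := by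
    intro s hs hsε N hN
    have hz := h1 (y := s) (by simpa [abs_of_pos hs] using hsε) hs
    have hs' : |(1 / 2 : ℝ)| ≤ 1 := by rw [abs_of_pos] <;> norm_num
    have hsum := hasSum_divisorTau hs' (by linarith : 1 < 1 + s)
    have h2 : ∑ n ∈ Finset.Ioc 0 N, divisorTau (1 / 2) n / n ≤
        Real.exp 1 * ∑ n ∈ Finset.Ioc 0 N, divisorTau (1 / 2) n * (n : ℝ) ^ (-(1 + s)) := by
      rw [Finset.mul_sum]
      refine Finset.sum_le_sum fun n hn => ?_
      rw [Finset.mem_Ioc] at hn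
      have hn0 : (0 : ℝ) < n := by exact_mod_cast hn.1
      have hnN : (n : ℝ) ≤ Real.exp (1 / s) := le_trans (by exact_mod_cast hn.2) hN
      have h3 : (n : ℝ) ^ s ≤ Real.exp 1 := by
        calc (n : ℝ) ^ s ≤ (Real.exp (1 / s)) ^ s := by gcongr
          _ = Real.exp 1 := by rw [← Real.exp_mul]; congr 1; field_simp
      rw [neg_add, Real.rpow_add hn0, Real.rpow_neg_one, Real.rpow_neg hn0.le s]
      have h4 : 0 < (n : ℝ) ^ s := by positivity
      have h5 : 0 ≤ divisorTau (1 / 2) n / n := div_nonneg (divisorTau_nonneg (by norm_num) n) hn0.le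
      calc divisorTau (1 / 2) n / n = divisorTau (1 / 2) n / n * 1 := by ring
        _ ≤ divisorTau (1 / 2) n / n * (Real.exp 1 * ((n : ℝ) ^ s)⁻¹) := by
          refine mul_le_mul_of_nonneg_left ?_ h5
          rw [← div_eq_mul_inv, le_div_iff₀ h4]
          linarith
        _ = _ := by field_simp
    have h6 : ∑ n ∈ Finset.Ioc 0 N, divisorTau (1 / 2) n * (n : ℝ) ^ (-(1 + s)) ≤
        (∑' n : ℕ, (n : ℝ) ^ (-(1 + s))) ^ (1 / 2 : ℝ) :=
      sum_le_hasSum _ (fun n _ => mul_nonneg (divisorTau_nonneg (by norm_num) n) (by positivity))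
        hsum
    have h7 : (∑' n : ℕ, (n : ℝ) ^ (-(1 + s))) ^ (1 / 2 : ℝ) ≤ 2 * √(1 / s) := by
      rw [← Real.sqrt_eq_rpow]
      have : (2 : ℝ) * √(1 / s) = √(4 * (1 / s)) := by
        rw [Real.sqrt_mul (by norm_num)]
        congr 1
        rw [show (4 : ℝ) = 2 ^ 2 by norm_num, Real.sqrt_sq (by norm_num)]
      rw [this]
      apply Real.sqrt_le_sqrt
      rw [mul_one_div, le_div_iff₀ hs]
      linarith
    calc _ ≤ _ := h2
      _ ≤ Real.exp 1 * (2 * √(1 / s)) := by gcongr; exact h6.trans h7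
      _ = _ := by ring
  -- With s = 1/(l + A) one has s ≤ ε/2 for every l ≥ 0, so small l needs no separate treatment.
  set A : ℝ := 2 / ε with hA
  have hA0 : 0 < A := by positivity
  refine ⟨Real.exp 1 * 2 * √(1 + A), by positivity, fun l hl N hN => ?_⟩
  have h := main (1 / (l + A)) (by positivity) (by
    rw [div_lt_iff₀ (by positivity)]
    have : ε * A = 2 := by rw [hA]; field_simp
    nlinarith) N (by
      rw [one_div_one_div]
      exact hN.trans (Real.exp_le_exp.mpr (by linarith)))
  rw [one_div_one_div] at h
  refine h.trans ?_
  rw [mul_assoc _ _ (√(1 + l)), ← Real.sqrt_mul (by positivity)]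
  gcongr
  nlinarith

/-! ### Elementary logarithmic sums and Mertens' theorem to second order. -/

theorem log_add_one_sub_log_le {n : ℕ} (hn : 0 < n) :
    Real.log (n + 1) - Real.log n ≤ 1 / n := by
  have hn0 : (0 : ℝ) < n := by exact_mod_cast hn
  rw [← Real.log_div (by positivity) (by positivity)]
  refine (Real.log_le_sub_one_of_pos (by positivity)).trans_eq ?_
  field_simp
  ring

theorem le_log_add_one_sub_log {n : ℕ} (hn : 0 < n) :
    1 / (n + 1) ≤ Real.log (n + 1) - Real.log n := by
  have hn0 : (0 : ℝ) < n := by exact_mod_cast hn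
  rw [← Real.log_div (by positivity) (by positivity)]
  refine le_trans (le_of_eq ?_) (Real.one_sub_inv_le_log_of_pos (by positivity))
  field_simp
  ring

theorem sum_log_bounds (N : ℕ) (hN : 0 < N) :
    N * Real.log N - N ≤ ∑ n ∈ Finset.Ioc 0 N, Real.log n ∧
      ∑ n ∈ Finset.Ioc 0 N, Real.log n ≤ N * Real.log N := by
  constructor
  · induction N, hN using Nat.le_induction with
    | base => simp
    | succ n hn ih =>
      rw [Finset.sum_Ioc_succ_top (by omega)]
      have h := log_add_one_sub_log_le hn
      have hn0 : (0 : ℝ) < n := by exact_mod_cast hn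
      rw [le_div_iff₀ hn0] at h
      push_cast
      linarith
  · refine (Finset.sum_le_card_nsmul _ _ (Real.log N) fun n hn => ?_).trans_eq (by simp)
    rw [Finset.mem_Ioc] at hn
    exact Real.log_le_log (by exact_mod_cast hn.1) (by exact_mod_cast hn.2)

/-- Only the bounds log² N / 2 + O(1) are needed later; the terms with N in the denominator
strengthen the claim so that the induction closes. -/
theorem sum_log_div_bounds (N : ℕ) (hN : 0 < N) :
    Real.log N ^ 2 / 2 - 2 + (Real.log N + 2) / N ≤ ∑ n ∈ Finset.Ioc 0 N, Real.log n / n ∧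
      ∑ n ∈ Finset.Ioc 0 N, Real.log n / n ≤ Real.log N ^ 2 / 2 + 1 / 2 - 1 / (2 * N) := by
  induction N, hN using Nat.le_induction with
  | base => simp
  | succ n hn ih =>
    rw [Finset.sum_Ioc_succ_top (by omega)]
    have hn0 : (0 : ℝ) < n := by exact_mod_cast hn
    have h1 := log_add_one_sub_log_le hn
    have h2 := le_log_add_one_sub_log hn
    have hb : 0 ≤ Real.log n := Real.log_natCast_nonneg n
    push_cast
    set a := Real.log (n + 1)
    set b := Real.log n
    have e1 : a = b + (a - b) := by ring
    set u := a - b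
    rw [e1]
    have hu : u * n ≤ 1 := by rwa [le_div_iff₀ hn0] at h1
    have hu' : 1 ≤ u * (n + 1) := by rwa [div_le_iff₀ (by positivity)] at h2
    have hu0 : 0 ≤ u := le_trans (by positivity) h2
    constructor
    · have key : (b + u) ^ 2 / 2 - 2 + (b + u + 2) / (n + 1) ≤
          b ^ 2 / 2 - 2 + (b + 2) / n + (b + u) / (n + 1) := by
        have : b ^ 2 / 2 - 2 + (b + 2) / n + (b + u) / (n + 1) -
            ((b + u) ^ 2 / 2 - 2 + (b + u + 2) / (n + 1)) =
            ((b * (1 - u * n) + (2 - u * (u * n) / 2 )) * (n + 1) - 2 * n) / (n * (n + 1)) := by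
          field_simp
          ring
        have h3 : 0 ≤ ((b * (1 - u * n) + (2 - u * (u * n) / 2 )) * (n + 1) - 2 * n)
            / (n * (n + 1)) := by
          apply div_nonneg _ (by positivity)
          have h4 : 0 ≤ b * (1 - u * n) * (n + 1) :=
            mul_nonneg (mul_nonneg hb (by linarith)) (by positivity)
          have h5 : u ≤ 1 := by
            refine h1.trans ?_
            rw [div_le_one hn0]
            exact_mod_cast hn
          have h6 : u * (u * n) * (n + 1) ≤ 2 := by
            calc u * (u * n) * (n + 1) ≤ u * 1 * (n + 1) := by gcongr
              _ = u * n + u := by ring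
              _ ≤ 2 := by linarith
          nlinarith
        linarith
      linarith [ih.1]
    · have key : b ^ 2 / 2 + 1 / 2 - 1 / (2 * n) + (b + u) / (n + 1) ≤
          (b + u) ^ 2 / 2 + 1 / 2 - 1 / (2 * (n + 1)) := by
        have : (b + u) ^ 2 / 2 + 1 / 2 - 1 / (2 * (n + 1)) -
            (b ^ 2 / 2 + 1 / 2 - 1 / (2 * n) + (b + u) / (n + 1)) =
            (2 * b * (u * (n + 1) - 1) * n + (u * n * (u * (n + 1) - 2) + 1)) /
              (2 * n * (n + 1)) := by
          field_simp
          ring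
        have h3 : 0 ≤ (2 * b * (u * (n + 1) - 1) * n + (u * n * (u * (n + 1) - 2) + 1)) /
              (2 * n * (n + 1)) := by
          apply div_nonneg _ (by positivity)
          have h4 : 0 ≤ 2 * b * (u * (n + 1) - 1) * n :=
            mul_nonneg (mul_nonneg (by positivity) (by linarith)) hn0.le
          have h5 : 0 ≤ u * n := by positivity
          nlinarith
        linarith
      linarith [ih.2]

theorem abs_harmonic_sub_log_le {n : ℕ} (hn : 0 < n) {y : ℝ} (h1 : (n : ℝ) ≤ y)
    (h2 : y ≤ n + 1) :
    |(harmonic n : ℝ) - Real.log y - Real.eulerMascheroniConstant| ≤ 2 / y := by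
  have hn0 : (0 : ℝ) < n := by exact_mod_cast hn
  have hn1 : (1 : ℝ) ≤ n := by exact_mod_cast hn
  have a1 := Real.eulerMascheroniSeq_lt_eulerMascheroniConstant n
  have a2 := Real.eulerMascheroniConstant_lt_eulerMascheroniSeq' n
  rw [Real.eulerMascheroniSeq] at a1
  rw [Real.eulerMascheroniSeq', if_neg hn.ne'] at a2
  have b1 := Real.log_le_log hn0 h1
  have b2 := Real.log_le_log (hn0.trans_le h1) h2
  have b3 := log_add_one_sub_log_le hn
  have b4 : (1 : ℝ) / n ≤ 2 / y := by
    rw [div_le_div_iff₀ hn0 (by linarith)]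
    linarith
  rw [abs_le]
  constructor <;> linarith

open ArithmeticFunction in
theorem sum_mul_log_eq_sum_vonMangoldt (g : ℕ → ℝ) (N : ℕ) :
    ∑ n ∈ Finset.Ioc 0 N, g n * Real.log n =
      ∑ k ∈ Finset.Ioc 0 N, vonMangoldt k * ∑ m ∈ Finset.Ioc 0 (N / k), g (k * m) := by
  simp_rw [Finset.mul_sum]
  rw [← sum_Ioc_sum_divisorsAntidiagonal (fun k m => vonMangoldt k * g (k * m))]
  refine Finset.sum_congr rfl fun n _ => ?_
  rw [← vonMangoldt_sum, Finset.mul_sum, ← Nat.sum_divisorsAntidiagonal (fun i _ => g n * vonMangoldt i)]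
  refine Finset.sum_congr rfl fun x hx => ?_
  rw [(Nat.mem_divisorsAntidiagonal.mp hx).1, mul_comm]

open ArithmeticFunction in
theorem sum_vonMangoldt_floor_exp_le (l : ℝ) :
    ∑ k ∈ Finset.Ioc 0 ⌊Real.exp l⌋₊, vonMangoldt k ≤ (Real.log 4 + 4) * Real.exp l :=
  Chebyshev.psi_le_const_mul_self (Real.exp_pos l).le

theorem one_le_floor_exp {l : ℝ} (hl : 0 ≤ l) : 0 < ⌊Real.exp l⌋₊ :=
  Nat.floor_pos.mpr (Real.one_le_exp hl)

theorem floor_exp_log_bounds {l : ℝ} (hl : 0 ≤ l) :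
    Real.log ⌊Real.exp l⌋₊ ≤ l ∧ l ≤ Real.log ⌊Real.exp l⌋₊ + 1 / ⌊Real.exp l⌋₊ := by
  have hN := one_le_floor_exp hl
  have hN0 : (0 : ℝ) < ⌊Real.exp l⌋₊ := by exact_mod_cast hN
  constructor
  · rw [Real.log_le_iff_le_exp hN0]
    exact Nat.floor_le (Real.exp_pos l).le
  · have h1 : l ≤ Real.log (⌊Real.exp l⌋₊ + 1) := by
      rw [Real.le_log_iff_exp_le (by positivity)]
      exact (Nat.lt_floor_add_one _).le
    linarith [log_add_one_sub_log_le hN]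

open ArithmeticFunction in
/-- Mertens' first theorem in terms of the von Mangoldt function. -/
theorem abs_sum_vonMangoldt_div_sub_le {l : ℝ} (hl : 0 ≤ l) :
    |∑ k ∈ Finset.Ioc 0 ⌊Real.exp l⌋₊, vonMangoldt k / k - l| ≤ Real.log 4 + 4 := by
  set x := Real.exp l with hx
  set N := ⌊x⌋₊ with hN
  have hx0 : 0 < x := Real.exp_pos l
  have hNpos : 0 < N := one_le_floor_exp hl
  have hN0 : (0 : ℝ) < N := by exact_mod_cast hNpos
  have hNx : (N : ℝ) ≤ x := Nat.floor_le hx0.le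
  have hxN : x < N + 1 := Nat.lt_floor_add_one x
  obtain ⟨hlog1, hlog2⟩ := floor_exp_log_bounds hl
  rw [← hx, ← hN] at hlog1 hlog2
  obtain ⟨hs1, hs2⟩ := sum_log_bounds N hNpos
  have hid := sum_mul_log_eq_sum_vonMangoldt (fun _ => 1) N
  simp only [one_mul, Finset.sum_const, Nat.card_Ioc, tsub_zero, nsmul_eq_mul, mul_one] at hid
  have hpsi := sum_vonMangoldt_floor_exp_le l
  rw [← hx, ← hN] at hpsi
  set S := ∑ k ∈ Finset.Ioc 0 N, vonMangoldt k / (k : ℝ) with hS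
  have hup : ∑ k ∈ Finset.Ioc 0 N, vonMangoldt k * ((N / k : ℕ) : ℝ) ≤ x * S := by
    rw [hS, Finset.mul_sum]
    refine Finset.sum_le_sum fun k hk => ?_
    have hk0 : (0 : ℝ) < k := by exact_mod_cast (Finset.mem_Ioc.mp hk).1
    have : ((N / k : ℕ) : ℝ) ≤ x / k := Nat.cast_div_le.trans (by gcongr)
    calc _ ≤ vonMangoldt k * (x / k) := mul_le_mul_of_nonneg_left this vonMangoldt_nonneg
      _ = _ := by ring
  -- Rounding x/k down to an integer costs ψ(N) in total, which Chebyshev's bound makes O(x).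
  have hlo : x * S ≤ ∑ k ∈ Finset.Ioc 0 N, vonMangoldt k * ((N / k : ℕ) : ℝ) +
      ∑ k ∈ Finset.Ioc 0 N, vonMangoldt k := by
    rw [hS, Finset.mul_sum, ← Finset.sum_add_distrib]
    refine Finset.sum_le_sum fun k hk => ?_
    have : x / k ≤ ((N / k : ℕ) : ℝ) + 1 := by
      rw [hN, ← Nat.floor_div_natCast]
      exact (Nat.lt_floor_add_one _).le
    calc x * (vonMangoldt k / k) = vonMangoldt k * (x / k) := by ring
      _ ≤ vonMangoldt k * (((N / k : ℕ) : ℝ) + 1) :=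
        mul_le_mul_of_nonneg_left this vonMangoldt_nonneg
      _ = _ := by ring
  rw [← hid] at hup hlo
  have h4 : 0 ≤ Real.log 4 := Real.log_nonneg (by norm_num)
  have hlx : l + 1 ≤ x := Real.add_one_le_exp l
  rw [abs_le]
  constructor
  · have h1 : l * N ≤ N * Real.log N + 1 := by
      calc l * N ≤ (Real.log N + 1 / N) * N := by gcongr
        _ = _ := by field_simp
    have h2 : l * x ≤ l * (N + 1) := by gcongr
    have h3 : x * (l - 2) ≤ x * S := by nlinarith
    have h5 := le_of_mul_le_mul_left h3 hx0
    linarith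
  · have h1 : (N : ℝ) * Real.log N ≤ x * l := by
      have : 0 ≤ Real.log N := Real.log_natCast_nonneg N
      gcongr
    have h3 : x * S ≤ x * (l + (Real.log 4 + 4)) := by linarith
    have h5 := le_of_mul_le_mul_left h3 hx0
    linarith

open ArithmeticFunction in
-- Since Λ * 1 = log, ∑ log n / n equals ∑ Λ(k)/k · H(N/k) with H the harmonic numbers. Inserting
-- H(N/k) = log(x/k) + γ + O(k/x) produces the wanted sum plus γ ∑ Λ(k)/k, and the latter is γl +
-- O(1) by Mertens. The error is O(ψ(x)/x) = O(1).
theorem abs_sum_vonMangoldt_div_mul_sub_le :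
    ∃ K : ℝ, 0 < K ∧ ∀ l : ℝ, 0 ≤ l →
      |∑ k ∈ Finset.Ioc 0 ⌊Real.exp l⌋₊, vonMangoldt k / k * (l - Real.log k) -
        (l ^ 2 / 2 - Real.eulerMascheroniConstant * l)| ≤ K := by
  have h4 : 0 ≤ Real.log 4 := Real.log_nonneg (by norm_num)
  have hγ := Real.one_half_lt_eulerMascheroniConstant
  set γ := Real.eulerMascheroniConstant with hγdef
  refine ⟨4 + (2 + γ) * (Real.log 4 + 4), by positivity, fun l hl => ?_⟩
  have hM := abs_sum_vonMangoldt_div_sub_le hl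
  set x := Real.exp l with hx
  set N := ⌊x⌋₊ with hN
  have hx0 : 0 < x := Real.exp_pos l
  have hNpos : 0 < N := one_le_floor_exp hl
  have hN1 : (1 : ℝ) ≤ N := by exact_mod_cast hNpos
  have hNx : (N : ℝ) ≤ x := Nat.floor_le hx0.le
  obtain ⟨hlog1, hlog2⟩ := floor_exp_log_bounds hl
  rw [← hx, ← hN] at hlog1 hlog2
  obtain ⟨hs1, hs2⟩ := sum_log_div_bounds N hNpos
  have hpsi := sum_vonMangoldt_floor_exp_le l
  rw [← hx, ← hN] at hpsi
  have hid : ∑ n ∈ Finset.Ioc 0 N, Real.log n / n =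
      ∑ k ∈ Finset.Ioc 0 N, vonMangoldt k / k * (harmonic (N / k) : ℝ) := by
    have h := sum_mul_log_eq_sum_vonMangoldt (fun n => (n : ℝ)⁻¹) N
    calc _ = ∑ n ∈ Finset.Ioc 0 N, (n : ℝ)⁻¹ * Real.log n :=
          Finset.sum_congr rfl fun n _ => by ring
      _ = _ := h
      _ = _ := by
        refine Finset.sum_congr rfl fun k _ => ?_
        have hI : Finset.Icc 1 (N / k) = Finset.Ioc 0 (N / k) := by
          ext i
          rw [Finset.mem_Icc, Finset.mem_Ioc, Nat.succ_le_iff]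
        rw [harmonic_eq_sum_Icc, div_eq_mul_inv, mul_assoc, hI]
        push_cast
        simp only [mul_inv, Finset.mul_sum]
  set S := ∑ k ∈ Finset.Ioc 0 N, vonMangoldt k / (k : ℝ) with hS
  have herr : |∑ k ∈ Finset.Ioc 0 N, vonMangoldt k / k * (harmonic (N / k) : ℝ) -
      ∑ k ∈ Finset.Ioc 0 N, vonMangoldt k / k * (l - Real.log k) - γ * S| ≤
      2 * (Real.log 4 + 4) := by
    rw [hS, Finset.mul_sum, ← Finset.sum_sub_distrib, ← Finset.sum_sub_distrib]
    refine (Finset.abs_sum_le_sum_abs _ _).trans ?_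
    have h1 : ∀ k ∈ Finset.Ioc 0 N, |vonMangoldt k / k * (harmonic (N / k) : ℝ) -
        vonMangoldt k / k * (l - Real.log k) - γ * (vonMangoldt k / k)| ≤
        vonMangoldt k * (2 / x) := by
      intro k hk
      rw [Finset.mem_Ioc] at hk
      have hk0 : (0 : ℝ) < k := by exact_mod_cast hk.1
      have hq : 0 < N / k := Nat.div_pos hk.2 hk.1
      have hfl : N / k = ⌊x / k⌋₊ := by rw [hN, Nat.floor_div_natCast]
      have h2 := abs_harmonic_sub_log_le hq (y := x / k)
        (by rw [hfl]; exact Nat.floor_le (by positivity))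
        (by rw [hfl]; exact (Nat.lt_floor_add_one _).le)
      rw [Real.log_div hx0.ne' hk0.ne', hx, Real.log_exp, ← hx] at h2
      have h3 : vonMangoldt k / k * (harmonic (N / k) : ℝ) -
        vonMangoldt k / k * (l - Real.log k) - γ * (vonMangoldt k / k) =
        vonMangoldt k / k * ((harmonic (N / k) : ℝ) - (l - Real.log k) - γ) := by ring
      rw [h3, abs_mul, abs_of_nonneg (div_nonneg vonMangoldt_nonneg hk0.le)]
      calc _ ≤ vonMangoldt k / k * (2 / (x / k)) :=
            mul_le_mul_of_nonneg_left h2 (div_nonneg vonMangoldt_nonneg hk0.le)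
        _ = _ := by field_simp
    refine (Finset.sum_le_sum h1).trans ?_
    rw [← Finset.sum_mul]
    calc _ ≤ (Real.log 4 + 4) * x * (2 / x) := by gcongr
      _ = _ := by field_simp
  rw [← hid] at herr
  have hlsq1 : Real.log N ^ 2 ≤ l ^ 2 := by
    have : 0 ≤ Real.log N := Real.log_natCast_nonneg N
    gcongr
  have hlsq2 : l ^ 2 ≤ Real.log N ^ 2 + 3 := by
    have h0 : 0 ≤ Real.log N := Real.log_natCast_nonneg N
    have h1 : Real.log N ≤ N := by linarith [Real.log_le_sub_one_of_pos (by linarith : (0:ℝ) < N)]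
    have h2 : Real.log N * (1 / N) ≤ 1 := by
      rw [mul_one_div, div_le_one (by linarith)]; exact h1
    have h3 : (1 : ℝ) / N ≤ 1 := by rw [div_le_one (by linarith)]; exact hN1
    have h5 : (0 : ℝ) ≤ 1 / N := by positivity
    calc l ^ 2 ≤ (Real.log N + 1 / N) ^ 2 := by gcongr
      _ ≤ _ := by nlinarith
  have hp1 : (0 : ℝ) ≤ 1 / (2 * N) := by positivity
  have hp2 : 0 ≤ (Real.log N + 2) / N := by
    have : 0 ≤ Real.log N := Real.log_natCast_nonneg N
    positivity
  have hγS : |γ * S - γ * l| ≤ γ * (Real.log 4 + 4) := by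
    rw [← mul_sub, abs_mul, abs_of_pos (by linarith : 0 < γ)]
    gcongr
  rw [abs_le] at herr hγS ⊢
  constructor <;> nlinarith

/-! ### Riesz means and their approximate differential equation. -/

/-- The first Riesz mean of `τ_{-1/2}(n) / n`, in the logarithmic variable `l = log x`. -/
noncomputable def rieszTau (l : ℝ) : ℝ :=
  ∑ n ∈ Finset.Ioc 0 ⌊Real.exp l⌋₊, divisorTau (-1 / 2) n / n * (l - Real.log n)

/-- The second Riesz mean of `τ_{-1/2}(n) / n`, in the logarithmic variable `l = log x`. -/
noncomputable def rieszTauSq (l : ℝ) : ℝ :=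
  ∑ n ∈ Finset.Ioc 0 ⌊Real.exp l⌋₊, divisorTau (-1 / 2) n / n * (l - Real.log n) ^ 2

theorem log_le_of_mem_Ioc_floor_exp {l : ℝ} {n : ℕ} (hn : n ∈ Finset.Ioc 0 ⌊Real.exp l⌋₊) :
    Real.log n ≤ l := by
  rw [Finset.mem_Ioc] at hn
  rw [Real.log_le_iff_le_exp (by exact_mod_cast hn.1)]
  exact (Nat.le_floor_iff (Real.exp_pos l).le).mp hn.2

theorem le_log_of_floor_exp_lt {l : ℝ} {n : ℕ} (hn : ⌊Real.exp l⌋₊ < n) : l ≤ Real.log n := by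
  have hn0 : (0 : ℝ) < n := by exact_mod_cast (Nat.zero_le _).trans_lt hn
  rw [Real.le_log_iff_exp_le hn0]
  exact (Nat.lt_of_floor_lt hn).le

/-- Positive parts make the index range independent of l, so sums can be differentiated or
integrated in l term by term. The exponent must be nonzero for the extra terms to vanish. -/
theorem sum_Ioc_floor_exp_eq (g : ℕ → ℝ) (l : ℝ) {N : ℕ} (hN : ⌊Real.exp l⌋₊ ≤ N) {j : ℕ}
    (hj : j ≠ 0) :
    ∑ n ∈ Finset.Ioc 0 ⌊Real.exp l⌋₊, g n * (l - Real.log n) ^ j =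
      ∑ n ∈ Finset.Ioc 0 N, g n * (max (l - Real.log n) 0) ^ j := by
  rw [← Finset.sum_subset (Finset.Ioc_subset_Ioc_right hN) (f := fun n => g n * (max (l - Real.log n) 0) ^ j)]
  · refine Finset.sum_congr rfl fun n hn => ?_
    rw [max_eq_left (sub_nonneg.mpr (log_le_of_mem_Ioc_floor_exp hn))]
  · intro n hn hn'
    rw [Finset.mem_Ioc] at hn hn'
    have : ⌊Real.exp l⌋₊ < n := by
      by_contra h
      exact hn' ⟨hn.1, not_lt.mp h⟩
    rw [max_eq_right (sub_nonpos.mpr (le_log_of_floor_exp_lt this)), zero_pow hj, mul_zero]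

theorem rieszTau_eq {l : ℝ} {N : ℕ} (hN : ⌊Real.exp l⌋₊ ≤ N) :
    rieszTau l = ∑ n ∈ Finset.Ioc 0 N, divisorTau (-1 / 2) n / n * max (l - Real.log n) 0 := by
  have := sum_Ioc_floor_exp_eq (fun n => divisorTau (-1 / 2) n / n) l hN one_ne_zero
  simp only [pow_one] at this
  exact this

theorem rieszTauSq_eq {l : ℝ} {N : ℕ} (hN : ⌊Real.exp l⌋₊ ≤ N) :
    rieszTauSq l =
      ∑ n ∈ Finset.Ioc 0 N, divisorTau (-1 / 2) n / n * (max (l - Real.log n) 0) ^ 2 :=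
  sum_Ioc_floor_exp_eq (fun n => divisorTau (-1 / 2) n / n) l hN two_ne_zero

theorem hasDerivAt_max_zero_sq (x : ℝ) : HasDerivAt (fun y : ℝ => max y 0 ^ 2) (2 * max x 0) x := by
  rcases lt_trichotomy x 0 with hx | rfl | hx
  · rw [max_eq_right hx.le, mul_zero]
    refine (hasDerivAt_const x (0 : ℝ)).congr_of_eventuallyEq ?_
    filter_upwards [eventually_lt_nhds hx] with y hy
    simp [max_eq_right hy.le]
  · have h : (fun y : ℝ => max y 0 ^ 2) =O[𝓝 0] fun y => ‖y - 0‖ ^ 2 := by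
      refine Asymptotics.IsBigO.of_bound 1 (Eventually.of_forall fun y => ?_)
      simp only [sub_zero, norm_pow, Real.norm_eq_abs, abs_abs, one_mul]
      refine pow_le_pow_left₀ (abs_nonneg _) ?_ 2
      rcases le_total y 0 with h | h <;> simp [h]
    have := (h.hasFDerivAt (by norm_num)).hasDerivAt
    simpa using this
  · rw [max_eq_left hx.le]
    have := (hasDerivAt_id x).pow 2
    simp only [id_eq, Nat.cast_ofNat, Nat.add_one_sub_one, pow_one, mul_one] at this
    refine this.congr_of_eventuallyEq ?_
    filter_upwards [eventually_gt_nhds hx] with y hy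
    simp [max_eq_left hy.le]

theorem hasDerivAt_rieszTauSq (l : ℝ) : HasDerivAt rieszTauSq (2 * rieszTau l) l := by
  -- A single index range valid on a whole neighbourhood of l.
  set N := ⌊Real.exp (l + 1)⌋₊
  have hN : ∀ y ≤ l + 1, ⌊Real.exp y⌋₊ ≤ N := fun y hy =>
    Nat.floor_le_floor (Real.exp_le_exp.mpr hy)
  have h : HasDerivAt (fun y => ∑ n ∈ Finset.Ioc 0 N, divisorTau (-1 / 2) n / n *
      (max (y - Real.log n) 0) ^ 2) (∑ n ∈ Finset.Ioc 0 N, divisorTau (-1 / 2) n / n *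
      (2 * max (l - Real.log n) 0)) l := by
    refine HasDerivAt.fun_sum fun n _ => HasDerivAt.const_mul _ ?_
    have := (hasDerivAt_max_zero_sq (l - Real.log n)).comp l
      ((hasDerivAt_id l).sub_const (Real.log n))
    simpa [Function.comp_def] using this
  have e : 2 * rieszTau l = ∑ n ∈ Finset.Ioc 0 N, divisorTau (-1 / 2) n / n *
      (2 * max (l - Real.log n) 0) := by
    rw [rieszTau_eq (hN l (by linarith)), Finset.mul_sum]
    exact Finset.sum_congr rfl fun n _ => by ring
  rw [e]
  refine h.congr_of_eventuallyEq ?_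
  filter_upwards [eventually_lt_nhds (lt_add_one l)] with y hy
  exact rieszTauSq_eq (hN y hy.le)

open ArithmeticFunction in
-- Weighting by log n gives l R - R₂ on one side and, through τ_{-1/2} · log = -½ Λ * τ_{-1/2}, the
-- sum -½ ∑ τ_{-1/2}(b)/b · M(l - log b) on the other. Since M(u) = u²/2 - γu + O(1), the latter is
-- -R₂/4 + γR/2, up to a multiple of ∑ τ_{1/2}(b)/b = O(√(1+l)).
theorem abs_rieszTau_relation_le :
    ∃ K : ℝ, 0 < K ∧ ∀ l : ℝ, 0 ≤ l →
      |(l - Real.eulerMascheroniConstant / 2) * rieszTau l - 3 / 4 * rieszTauSq l| ≤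
        K * √(1 + l) := by
  obtain ⟨K₁, hK₁, h₁⟩ := sum_divisorTau_half_div_le
  obtain ⟨K₂, hK₂, h₂⟩ := abs_sum_vonMangoldt_div_mul_sub_le
  refine ⟨K₁ * K₂, by positivity, fun l hl => ?_⟩
  set N := ⌊Real.exp l⌋₊ with hN
  have hNx : (N : ℝ) ≤ Real.exp l := Nat.floor_le (Real.exp_pos l).le
  set M : ℝ → ℝ := fun u =>
    ∑ k ∈ Finset.Ioc 0 ⌊Real.exp u⌋₊, vonMangoldt k / k * (u - Real.log k) with hM
  have hid : ∑ n ∈ Finset.Ioc 0 N, divisorTau (-1 / 2) n / n * Real.log n * (l - Real.log n) =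
      -1 / 2 * ∑ b ∈ Finset.Ioc 0 N, divisorTau (-1 / 2) b / b * M (l - Real.log b) := by
    have e1 : ∀ b ∈ Finset.Ioc 0 N, divisorTau (-1 / 2) b / b * M (l - Real.log b) =
        ∑ a ∈ Finset.Ioc 0 (N / b), vonMangoldt a * divisorTau (-1 / 2) b / (a * b) *
          (l - (Real.log b + Real.log a)) := by
      intro b hb
      rw [Finset.mem_Ioc] at hb
      have hb0 : (0 : ℝ) < b := by exact_mod_cast hb.1
      have e2 : ⌊Real.exp (l - Real.log b)⌋₊ = N / b := by
        rw [Real.exp_sub, Real.exp_log hb0, Nat.floor_div_natCast]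
      rw [hM]
      simp only
      rw [e2, Finset.mul_sum]
      refine Finset.sum_congr rfl fun a ha => ?_
      have ha0 : (0 : ℝ) < a := by exact_mod_cast (Finset.mem_Ioc.mp ha).1
      field_simp
      ring
    rw [Finset.sum_congr rfl e1, ← sum_Ioc_sum_divisorsAntidiagonal (fun b a => vonMangoldt a *
      divisorTau (-1 / 2) b / (a * b) * (l - (Real.log b + Real.log a))), Finset.mul_sum]
    refine Finset.sum_congr rfl fun n hn => ?_
    have hn0 : n ≠ 0 := (Finset.mem_Ioc.mp hn).1.ne'
    have h3 := divisorTau_mul_log (-1 / 2) n hn0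
    rw [← Nat.sum_divisorsAntidiagonal' (fun b a => vonMangoldt a * divisorTau (-1 / 2) b)] at h3
    have h4 : ∀ x ∈ n.divisorsAntidiagonal, vonMangoldt x.2 * divisorTau (-1 / 2) x.1 /
        ((x.2 : ℝ) * x.1) * (l - (Real.log x.1 + Real.log x.2)) =
        (vonMangoldt x.2 * divisorTau (-1 / 2) x.1) * ((l - Real.log n) / n) := by
      intro x hx
      have hx' := (Nat.mem_divisorsAntidiagonal.mp hx).1
      have a1 : (x.1 : ℝ) ≠ 0 := by
        have := Nat.ne_zero_of_mem_divisorsAntidiagonal hx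
        exact_mod_cast this.1
      have a2 : (x.2 : ℝ) ≠ 0 := by
        have := Nat.ne_zero_of_mem_divisorsAntidiagonal hx
        exact_mod_cast this.2
      rw [← hx', Nat.cast_mul, Real.log_mul a1 a2]
      field_simp
    rw [Finset.sum_congr rfl h4, ← Finset.sum_mul]
    linear_combination ((l - Real.log n) / n) * h3
  have hLHS : ∑ n ∈ Finset.Ioc 0 N, divisorTau (-1 / 2) n / n * Real.log n * (l - Real.log n) =
      l * rieszTau l - rieszTauSq l := by
    rw [rieszTau, rieszTauSq, Finset.mul_sum, ← Finset.sum_sub_distrib]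
    exact Finset.sum_congr rfl fun n _ => by ring
  have herr : |∑ b ∈ Finset.Ioc 0 N, divisorTau (-1 / 2) b / b * M (l - Real.log b) -
      (rieszTauSq l / 2 - Real.eulerMascheroniConstant * rieszTau l)| ≤ K₂ * (K₁ * √(1 + l)) := by
    have e : ∑ b ∈ Finset.Ioc 0 N, divisorTau (-1 / 2) b / b * M (l - Real.log b) -
        (rieszTauSq l / 2 - Real.eulerMascheroniConstant * rieszTau l) =
        ∑ b ∈ Finset.Ioc 0 N, divisorTau (-1 / 2) b / b * (M (l - Real.log b) -
          ((l - Real.log b) ^ 2 / 2 - Real.eulerMascheroniConstant * (l - Real.log b))) := by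
      rw [rieszTau, rieszTauSq, Finset.sum_div, Finset.mul_sum, ← Finset.sum_sub_distrib,
        ← Finset.sum_sub_distrib]
      exact Finset.sum_congr rfl fun n _ => by ring
    rw [e]
    refine (Finset.abs_sum_le_sum_abs _ _).trans ?_
    refine le_trans (Finset.sum_le_sum (g := fun b : ℕ => K₂ * (divisorTau (1 / 2) b / b)) ?_) ?_
    · intro b hb
      have hlb := log_le_of_mem_Ioc_floor_exp hb
      rw [abs_mul, abs_div, Nat.abs_cast, mul_comm]
      have h5 := abs_divisorTau_neg_half_le b
      have h6 := h₂ (l - Real.log b) (sub_nonneg.mpr hlb)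
      gcongr
    · rw [← Finset.mul_sum]
      gcongr
      exact h₁ l hl N hNx
  rw [hLHS] at hid
  rw [abs_le] at herr ⊢
  have h7 : 0 ≤ K₁ * K₂ * √(1 + l) := by positivity
  constructor <;> nlinarith

/-- The integrating factor is (l - a)^(-3/2): J = g (l - a)^(-3/2) has derivative 2 (l - a)^(-5/2)
((l - a) f - ¾ g) = O((l - a)^(-2)). So J tends to a limit C with error O(1/(l - a)), whence g = C
(l - a)^(3/2) + O(√(l - a)), and the hypothesis turns this into f = ¾ C √(l - a) + O(1). -/
theorem exists_sqrt_asymptotic {f g : ℝ → ℝ} {a K : ℝ} (ha0 : 0 ≤ a) (ha1 : a ≤ 1 / 2)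
    (hg : ∀ l, HasDerivAt g (2 * f l) l)
    (h : ∀ l, 0 ≤ l → |(l - a) * f l - 3 / 4 * g l| ≤ K * √(1 + l)) :
    ∃ c K' : ℝ, ∀ l, 1 ≤ l → |f l - c * √l| ≤ K' := by
  have hK : 0 ≤ K := by
    have := (abs_nonneg _).trans (h 0 le_rfl)
    simpa using this
  have hm : ∀ l : ℝ, 1 ≤ l → 1 / 2 ≤ l - a := fun l hl => by linarith
  have hsq : ∀ l : ℝ, 1 ≤ l → √(1 + l) ≤ 2 * √(l - a) := fun l hl => by
    have e : (2 : ℝ) * √(l - a) = √(4 * (l - a)) := by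
      rw [Real.sqrt_mul (by norm_num), show (4 : ℝ) = 2 ^ 2 by norm_num,
        Real.sqrt_sq (by norm_num)]
    rw [e]
    exact Real.sqrt_le_sqrt (by linarith [hm l hl])
  set J : ℝ → ℝ := fun l => g l * (l - a) ^ (-(3 / 2) : ℝ) with hJ
  have hJd : ∀ l : ℝ, 1 ≤ l → ∃ D : ℝ, HasDerivAt J D l ∧ |D| ≤ 4 * K / (l - a) ^ 2 := by
    intro l hl
    have hml := hm l hl
    have hpos : 0 < l - a := by linarith
    have h1 : HasDerivAt (fun y : ℝ => (y - a) ^ (-(3 / 2) : ℝ))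
        (1 * (-(3 / 2) : ℝ) * (l - a) ^ ((-(3 / 2) : ℝ) - 1)) l :=
      ((hasDerivAt_id l).sub_const a).rpow_const (Or.inl hpos.ne')
    refine ⟨_, (hg l).mul h1, ?_⟩
    have e1 : (l - a) ^ (-(3 / 2) : ℝ) = (l - a) ^ ((-(3 / 2) : ℝ) - 1) * (l - a) := by
      rw [← Real.rpow_add_one hpos.ne']
      norm_num
    have e2 : (l - a) ^ ((-(3 / 2) : ℝ) - 1) * √(l - a) = 1 / (l - a) ^ 2 := by
      rw [Real.sqrt_eq_rpow, ← Real.rpow_add hpos,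
        show (-(3 / 2) : ℝ) - 1 + 1 / 2 = -2 by norm_num, Real.rpow_neg hpos.le, Real.rpow_two,
        one_div]
    have hP : 0 < (l - a) ^ ((-(3 / 2) : ℝ) - 1) := by positivity
    rw [e1]
    have e3 : 2 * f l * ((l - a) ^ ((-(3 / 2) : ℝ) - 1) * (l - a)) +
        g l * (1 * (-(3 / 2) : ℝ) * (l - a) ^ ((-(3 / 2) : ℝ) - 1)) =
        2 * (l - a) ^ ((-(3 / 2) : ℝ) - 1) * ((l - a) * f l - 3 / 4 * g l) := by ring
    rw [e3, abs_mul, abs_of_pos (by positivity : 0 < 2 * (l - a) ^ ((-(3 / 2) : ℝ) - 1))]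
    calc _ ≤ 2 * (l - a) ^ ((-(3 / 2) : ℝ) - 1) * (K * (2 * √(l - a))) := by
          have := h l (by linarith)
          have h2 := hsq l hl
          gcongr
          exact this.trans (by gcongr)
      _ = 4 * K * ((l - a) ^ ((-(3 / 2) : ℝ) - 1) * √(l - a)) := by ring
      _ = _ := by rw [e2]; ring
  have hinv : ∀ l : ℝ, 1 ≤ l → HasDerivAt (fun y : ℝ => 4 * K / (y - a))
      (-(4 * K / (l - a) ^ 2)) l := by
    intro l hl
    have hpos : l - a ≠ 0 := by linarith [hm l hl]
    have := (hasDerivAt_const l (4 * K)).div ((hasDerivAt_id l).sub_const a) hpos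
    refine this.congr_deriv ?_
    simp only [id_eq]
    field_simp
    ring
  have hmono : MonotoneOn (fun l => J l - 4 * K / (l - a)) (Set.Ici 1) := by
    refine monotoneOn_of_deriv_nonneg (convex_Ici 1) ?_ ?_ ?_
    · intro l hl
      obtain ⟨D, hD, -⟩ := hJd l hl
      exact (hD.sub (hinv l hl)).continuousAt.continuousWithinAt
    · intro l hl
      rw [interior_Ici] at hl
      obtain ⟨D, hD, -⟩ := hJd l hl.le
      exact (hD.sub (hinv l hl.le)).differentiableAt.differentiableWithinAt
    · intro l hl
      rw [interior_Ici] at hl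
      obtain ⟨D, hD, hD'⟩ := hJd l hl.le
      rw [(hD.fun_sub (hinv l hl.le)).deriv]
      linarith [(abs_le.mp hD').1]
  have hanti : AntitoneOn (fun l => J l + 4 * K / (l - a)) (Set.Ici 1) := by
    refine antitoneOn_of_deriv_nonpos (convex_Ici 1) ?_ ?_ ?_
    · intro l hl
      obtain ⟨D, hD, -⟩ := hJd l hl
      exact (hD.add (hinv l hl)).continuousAt.continuousWithinAt
    · intro l hl
      rw [interior_Ici] at hl
      obtain ⟨D, hD, -⟩ := hJd l hl.le
      exact (hD.add (hinv l hl.le)).differentiableAt.differentiableWithinAt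
    · intro l hl
      rw [interior_Ici] at hl
      obtain ⟨D, hD, hD'⟩ := hJd l hl.le
      rw [(hD.fun_add (hinv l hl.le)).deriv]
      linarith [(abs_le.mp hD').2]
  have hub : ∀ l, 1 ≤ l → ∀ l', 1 ≤ l' → J l' - 4 * K / (l' - a) ≤ J l + 4 * K / (l - a) := by
    intro l hl l' hl'
    have h1 := hmono (Set.mem_Ici.mpr hl') (Set.mem_Ici.mpr (hl'.trans (le_max_right l l')))
      (le_max_right l l')
    have h2 := hanti (Set.mem_Ici.mpr hl) (Set.mem_Ici.mpr (hl.trans (le_max_left l l')))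
      (le_max_left l l')
    simp only at h1 h2
    have h3 : 0 ≤ 4 * K / (max l l' - a) :=
      div_nonneg (by positivity) (by linarith [hm _ (hl.trans (le_max_left l l'))])
    linarith
  -- J - 4K/(l - a) increases and J + 4K/(l - a) decreases, so the supremum of the former is the
  -- limit C of J and lies between the two at every l.
  set S : Set ℝ := (fun l => J l - 4 * K / (l - a)) '' Set.Ici 1 with hS
  have hbdd : BddAbove S := by
    refine ⟨J 1 + 4 * K / (1 - a), ?_⟩
    rintro _ ⟨l', hl', rfl⟩
    exact hub 1 le_rfl l' hl'
  have hne : S.Nonempty := ⟨_, 1, Set.self_mem_Ici, rfl⟩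
  set C := sSup S with hC
  have hCl : ∀ l, 1 ≤ l → |J l - C| ≤ 4 * K / (l - a) := by
    intro l hl
    have h1 : J l - 4 * K / (l - a) ≤ C := le_csSup hbdd ⟨l, hl, rfl⟩
    have h2 : C ≤ J l + 4 * K / (l - a) := by
      refine csSup_le hne ?_
      rintro _ ⟨l', hl', rfl⟩
      exact hub l hl l' hl'
    rw [abs_le]
    constructor <;> linarith
  refine ⟨3 / 4 * C, 10 * K + 3 / 4 * |C|, fun l hl => ?_⟩
  have hml := hm l hl
  have hpos : 0 < l - a := by linarith
  set r := √(l - a) with hr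
  have hr2 : r ^ 2 = l - a := Real.sq_sqrt hpos.le
  have hr0 : 0 < r := Real.sqrt_pos.mpr hpos
  have hr1 : 1 / 2 ≤ r := by
    rw [hr, Real.le_sqrt (by norm_num) hpos.le]
    linarith
  have hg' : g l = J l * r ^ 3 := by
    have : (l - a) ^ (-(3 / 2) : ℝ) * r ^ 3 = 1 := by
      rw [hr, Real.sqrt_eq_rpow, ← Real.rpow_natCast, ← Real.rpow_mul hpos.le,
        ← Real.rpow_add hpos]
      norm_num
    rw [hJ]
    simp only
    rw [mul_assoc, this, mul_one]
  have h1 := hCl l hl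
  rw [← hr2] at h1
  have h2 : |g l - C * r ^ 3| ≤ 4 * K * r := by
    rw [hg', ← sub_mul, abs_mul, abs_of_pos (by positivity : 0 < r ^ 3)]
    calc _ ≤ 4 * K / r ^ 2 * r ^ 3 := by gcongr
      _ = _ := by field_simp
  have h3 : |r ^ 2 * f l - 3 / 4 * g l| ≤ 2 * K * r := by
    rw [hr2]
    refine (h l (by linarith)).trans ?_
    calc _ ≤ K * (2 * r) := by gcongr; exact hsq l hl
      _ = _ := by ring
  have h4 : |r ^ 2 * (f l - 3 / 4 * C * r)| ≤ r ^ 2 * (10 * K) := by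
    have e : r ^ 2 * (f l - 3 / 4 * C * r) =
        (r ^ 2 * f l - 3 / 4 * g l) + 3 / 4 * (g l - C * r ^ 3) := by ring
    rw [e]
    refine (abs_add_le _ _).trans ?_
    rw [abs_mul, abs_of_pos (by norm_num : (0 : ℝ) < 3 / 4)]
    calc _ ≤ 2 * K * r + 3 / 4 * (4 * K * r) := by gcongr
      _ = r * 1 * (5 * K) := by ring
      _ ≤ r * (2 * r) * (5 * K) := by gcongr; linarith
      _ = _ := by ring
  rw [abs_mul, abs_of_pos (by positivity : 0 < r ^ 2)] at h4
  have h5 := le_of_mul_le_mul_left h4 (by positivity)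
  have h6 : |r - √l| ≤ 1 := by
    have hle : r ≤ √l := Real.sqrt_le_sqrt (by linarith)
    rw [abs_sub_comm, abs_of_nonneg (by linarith)]
    have : √l ≤ r + 1 := by
      rw [Real.sqrt_le_left (by positivity)]
      nlinarith
    linarith
  calc |f l - 3 / 4 * C * √l| = |(f l - 3 / 4 * C * r) + 3 / 4 * C * (r - √l)| := by ring_nf
    _ ≤ |f l - 3 / 4 * C * r| + |3 / 4 * C * (r - √l)| := abs_add_le _ _
    _ ≤ 10 * K + 3 / 4 * |C| * 1 := by
      rw [abs_mul, abs_mul, abs_of_pos (by norm_num : (0 : ℝ) < 3 / 4)]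
      gcongr
    _ = _ := by ring

theorem exists_abs_rieszTau_sub_le :
    ∃ c K : ℝ, 0 < K ∧ ∀ l : ℝ, |rieszTau l - c * √l| ≤ K := by
  obtain ⟨K₀, -, h₀⟩ := abs_rieszTau_relation_le
  obtain ⟨K₁, hK₁, h₁⟩ := sum_divisorTau_half_div_le
  have hγ1 := Real.one_half_lt_eulerMascheroniConstant
  have hγ2 := Real.eulerMascheroniConstant_lt_two_thirds
  obtain ⟨c, K, h⟩ := exists_sqrt_asymptotic (by linarith) (by linarith) hasDerivAt_rieszTauSq h₀
  have hK : 0 ≤ K := (abs_nonneg _).trans (h 1 le_rfl)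
  refine ⟨c, K + K₁ * √2 + |c|, by positivity, fun l => ?_⟩
  have hA : 0 ≤ K₁ * √2 := by positivity
  have hc := abs_nonneg c
  rcases le_total 1 l with hl | hl
  · exact (h l hl).trans (by linarith)
  rcases lt_or_ge l 0 with hl0 | hl0
  -- For l < 0 the sum is empty and `√l` is 0 by convention.
  · have : ⌊Real.exp l⌋₊ = 0 := Nat.floor_eq_zero.mpr (by simpa using hl0)
    rw [rieszTau, this, Real.sqrt_eq_zero_of_nonpos hl0.le]
    simp only [Finset.Ioc_self, Finset.sum_empty, mul_zero, sub_self, abs_zero]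
    linarith
  · have h2 : |rieszTau l| ≤ K₁ * √2 := by
      rw [rieszTau]
      refine (Finset.abs_sum_le_sum_abs _ _).trans ?_
      refine le_trans (Finset.sum_le_sum (g := fun b : ℕ => divisorTau (1 / 2) b / b) ?_) ?_
      · intro n hn
        have h3 := log_le_of_mem_Ioc_floor_exp hn
        have h4 : 0 ≤ Real.log n := Real.log_natCast_nonneg n
        rw [abs_mul, abs_div, Nat.abs_cast]
        have h5 := abs_divisorTau_neg_half_le n
        have h6 : 0 ≤ divisorTau (1 / 2) n := divisorTau_nonneg (by norm_num) n
        calc _ ≤ divisorTau (1 / 2) n / n * 1 := by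
              gcongr
              rw [abs_le]
              constructor <;> linarith
          _ = _ := mul_one _
      · refine (h₁ l hl0 _ (Nat.floor_le (Real.exp_pos l).le)).trans ?_
        gcongr
        linarith
    have h3 : |c * √l| ≤ |c| := by
      rw [abs_mul, abs_of_nonneg (Real.sqrt_nonneg l)]
      refine mul_le_of_le_one_right hc ?_
      rwa [Real.sqrt_le_one]
    calc |rieszTau l - c * √l| ≤ |rieszTau l| + |c * √l| := abs_sub _ _
      _ ≤ _ := by linarith

/-! ### The Laplace transform and the constant 2/√π. -/

open MeasureTheory in
theorem laplace_max_sub {a s : ℝ} (ha : 0 ≤ a) (hs : 0 < s) :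
    IntegrableOn (fun l => max (l - a) 0 * Real.exp (-(s * l))) (Set.Ioi 0) ∧
      ∫ l in Set.Ioi 0, max (l - a) 0 * Real.exp (-(s * l)) = Real.exp (-(s * a)) / s ^ 2 := by
  set f : ℝ → ℝ := fun u => max u 0 * Real.exp (-(s * u)) with hf
  have hf0 : ∀ u ∉ Set.Ioi (0 : ℝ), f u = 0 := fun u hu => by
    rw [hf]
    simp only
    rw [max_eq_right (not_lt.mp hu), zero_mul]
  have h1 : ∫ u, f u = 1 / s ^ 2 := by
    rw [← setIntegral_eq_integral_of_forall_compl_eq_zero hf0]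
    have h := Real.integral_rpow_mul_exp_neg_mul_Ioi (a := 2) (by norm_num) hs
    rw [Real.Gamma_two, mul_one, Real.rpow_two, div_pow, one_pow] at h
    rw [← h]
    refine setIntegral_congr_fun measurableSet_Ioi fun u hu => ?_
    simp only [hf]
    rw [max_eq_left (le_of_lt hu)]
    norm_num
  -- A nonintegrable function has integral 0 by convention, so a nonzero integral proves
  -- integrability.
  have hint : Integrable f := .of_integral_ne_zero (by rw [h1]; positivity)
  have e : ∀ l, max (l - a) 0 * Real.exp (-(s * l)) = Real.exp (-(s * a)) * f (l - a) := by
    intro l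
    rw [hf]
    simp only
    rw [mul_left_comm, ← Real.exp_add]
    ring_nf
  have hint' : Integrable (fun l => max (l - a) 0 * Real.exp (-(s * l))) := by
    simp_rw [e]
    exact (hint.comp_sub_right a).const_mul _
  refine ⟨hint'.integrableOn, ?_⟩
  rw [setIntegral_eq_integral_of_forall_compl_eq_zero]
  · simp_rw [e]
    rw [integral_const_mul, integral_sub_right_eq_self f a, h1]
    ring
  · intro l hl
    have : l - a ≤ 0 := by linarith [not_lt.mp (Set.mem_Ioi.not.mp hl)]
    rw [max_eq_right this, zero_mul]

open MeasureTheory in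
-- Each ramp (l - log n)₊ contributes n^(-s)/s², and absolute convergence of the Dirichlet series at
-- 1 + s justifies the interchange.
theorem laplace_rieszTau {s : ℝ} (hs : 0 < s) :
    ∫ l in Set.Ioi 0, rieszTau l * Real.exp (-(s * l)) =
      (∑' n : ℕ, (n : ℝ) ^ (-(1 + s))) ^ (-1 / 2 : ℝ) / s ^ 2 := by
  set F : ℕ → ℝ → ℝ := fun n l =>
    divisorTau (-1 / 2) n / n * (max (l - Real.log n) 0 * Real.exp (-(s * l))) with hF
  have hint : ∀ n, Integrable (F n) (volume.restrict (Set.Ioi 0)) := fun n =>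
    (laplace_max_sub (Real.log_natCast_nonneg n) hs).1.const_mul _
  have hexp : ∀ n : ℕ, (1 / (n : ℝ)) * (Real.exp (-(s * Real.log n)) / s ^ 2) =
      (n : ℝ) ^ (-(1 + s)) / s ^ 2 := by
    intro n
    rcases Nat.eq_zero_or_pos n with rfl | hn
    · simp [Real.zero_rpow (by linarith : -s + -1 ≠ 0)]
    · have hn0 : (0 : ℝ) < n := by exact_mod_cast hn
      rw [neg_add, Real.rpow_add hn0, Real.rpow_neg_one, Real.rpow_def_of_pos hn0]
      ring_nf
  have hval : ∀ n, ∫ l in Set.Ioi 0, F n l = divisorTau (-1 / 2) n * (n : ℝ) ^ (-(1 + s)) / s ^ 2 := by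
    intro n
    simp only [hF]
    rw [integral_const_mul, (laplace_max_sub (Real.log_natCast_nonneg n) hs).2, mul_div_assoc,
      ← hexp n]
    ring
  have hnorm : ∀ n, ∫ l in Set.Ioi 0, ‖F n l‖ = |divisorTau (-1 / 2) n| * (n : ℝ) ^ (-(1 + s)) / s ^ 2 := by
    intro n
    have : ∀ l, ‖F n l‖ = |divisorTau (-1 / 2) n| / n *
        (max (l - Real.log n) 0 * Real.exp (-(s * l))) := by
      intro l
      simp only [hF]
      rw [norm_mul, Real.norm_eq_abs, Real.norm_eq_abs, abs_div, Nat.abs_cast, abs_of_nonneg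
        (mul_nonneg (le_max_right _ _) (Real.exp_pos _).le)]
    simp_rw [this]
    rw [integral_const_mul, (laplace_max_sub (Real.log_natCast_nonneg n) hs).2, mul_div_assoc,
      ← hexp n]
    ring
  have hz : |(-1 / 2 : ℝ)| ≤ 1 := by rw [abs_of_neg] <;> norm_num
  have hsum : Summable fun n => ∫ l in Set.Ioi 0, ‖F n l‖ := by
    simp_rw [hnorm]
    refine Summable.div_const ?_ _
    refine Summable.of_nonneg_of_le (fun n => by positivity) (fun n => ?_)
      (Real.summable_nat_rpow.mpr (by linarith : -(1 + s) < -1))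
    exact mul_le_of_le_one_left (by positivity) (abs_divisorTau_le_one hz n)
  have h := hasSum_integral_of_summable_integral_norm hint hsum
  simp_rw [hval] at h
  have h2 := (hasSum_divisorTau hz (by linarith : 1 < 1 + s)).div_const (s ^ 2)
  rw [← h.unique h2]
  refine integral_congr_ae (Eventually.of_forall fun l => ?_)
  simp only
  rw [rieszTau_eq le_rfl, Finset.sum_mul, tsum_eq_sum (s := Finset.Ioc 0 ⌊Real.exp l⌋₊)]
  · exact Finset.sum_congr rfl fun n _ => by simp only [hF]; ring
  · intro n hn
    simp only [hF]
    rcases Nat.eq_zero_or_pos n with rfl | hn0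
    · simp
    · have : ⌊Real.exp l⌋₊ < n := by
        by_contra h
        exact hn (Finset.mem_Ioc.mpr ⟨hn0, not_lt.mp h⟩)
      rw [max_eq_right (sub_nonpos.mpr (le_log_of_floor_exp_lt this))]
      simp

/-- R is half the derivative of R₂, and derivatives are measurable. -/
theorem measurable_rieszTau : Measurable rieszTau := by
  have h : rieszTau = fun l => deriv rieszTauSq l / 2 := by
    funext l
    rw [(hasDerivAt_rieszTauSq l).deriv]
    ring
  rw [h]
  exact (measurable_deriv rieszTauSq).div_const 2

open MeasureTheory in
/-- The Riesz mean is asymptotic to `(2 / √π) √l`, with bounded error. -/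
theorem abs_rieszTau_sub_le :
    ∃ K : ℝ, 0 < K ∧ ∀ l : ℝ, |rieszTau l - 2 / √Real.pi * √l| ≤ K := by
  obtain ⟨c, K, hK, h⟩ := exists_abs_rieszTau_sub_le
  refine ⟨K, hK, ?_⟩
  suffices hc : c = 2 / √Real.pi by rwa [← hc]
  have hG : Real.Gamma (3 / 2) = √Real.pi / 2 := by
    rw [show (3 / 2 : ℝ) = 1 / 2 + 1 by norm_num, Real.Gamma_add_one (by norm_num),
      Real.Gamma_one_half_eq]
    ring
  suffices hc : c * (√Real.pi / 2) = 1 by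
    have : 0 < √Real.pi := Real.sqrt_pos.mpr Real.pi_pos
    field_simp
    linarith
  -- The Laplace transform of c√l is c Γ(3/2) s^(-3/2), and that of the bounded remainder is at most
  -- K/s. Multiplying by s^(3/2) compares (s ζ(1+s))^(-1/2), which tends to 1, with c Γ(3/2).
  have key : ∀ s : ℝ, 0 < s →
      |(s * ∑' n : ℕ, (n : ℝ) ^ (-(1 + s))) ^ (-1 / 2 : ℝ) - c * (√Real.pi / 2)| ≤ K * √s := by
    intro s hs
    have hexp : IntegrableOn (fun l : ℝ => Real.exp (-(s * l))) (Set.Ioi 0) ∧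
        ∫ l in Set.Ioi 0, Real.exp (-(s * l)) = 1 / s := by
      have h1 := Real.integral_rpow_mul_exp_neg_mul_Ioi (a := 1) (by norm_num) hs
      simp only [sub_self, Real.rpow_zero, one_mul, Real.rpow_one, Real.Gamma_one, mul_one] at h1
      exact ⟨.of_integral_ne_zero (by rw [h1]; positivity), h1⟩
    have hsqrt : IntegrableOn (fun l : ℝ => √l * Real.exp (-(s * l))) (Set.Ioi 0) ∧
        ∫ l in Set.Ioi 0, √l * Real.exp (-(s * l)) = (√Real.pi / 2) * (1 / s) ^ (3 / 2 : ℝ) := by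
      have h1 := Real.integral_rpow_mul_exp_neg_mul_Ioi (a := 3 / 2) (by norm_num) hs
      rw [hG, mul_comm _ (√Real.pi / 2)] at h1
      norm_num [← Real.sqrt_eq_rpow] at h1
      norm_num
      have hpi : 0 < √Real.pi := Real.sqrt_pos.mpr Real.pi_pos
      exact ⟨.of_integral_ne_zero (by rw [h1]; positivity), h1⟩
    have hb1 : IntegrableOn (fun l => (rieszTau l - c * √l) * Real.exp (-(s * l))) (Set.Ioi 0) := by
      refine (hexp.1.const_mul K).mono' ?_ (Eventually.of_forall fun l => ?_)
      · refine Measurable.aestronglyMeasurable ?_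
        have := measurable_rieszTau
        fun_prop
      · rw [norm_mul, Real.norm_eq_abs, Real.norm_eq_abs, Real.abs_exp]
        gcongr
        exact h l
    have hb2 : |∫ l in Set.Ioi 0, (rieszTau l - c * √l) * Real.exp (-(s * l))| ≤ K * (1 / s) := by
      rw [← hexp.2, ← integral_const_mul, ← Real.norm_eq_abs]
      refine norm_integral_le_of_norm_le (hexp.1.const_mul K) (Eventually.of_forall fun l => ?_)
      rw [norm_mul, Real.norm_eq_abs, Real.norm_eq_abs, Real.abs_exp]
      gcongr
      exact h l
    have hsplit : ∫ l in Set.Ioi 0, rieszTau l * Real.exp (-(s * l)) =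
        (∫ l in Set.Ioi 0, (rieszTau l - c * √l) * Real.exp (-(s * l))) +
          c * ((√Real.pi / 2) * (1 / s) ^ (3 / 2 : ℝ)) := by
      rw [← hsqrt.2, ← integral_const_mul, ← integral_add hb1 (hsqrt.1.const_mul c)]
      congr 1
      funext l
      ring
    rw [laplace_rieszTau hs] at hsplit
    set Z := ∑' n : ℕ, (n : ℝ) ^ (-(1 + s)) with hZ
    have hZ0 : 0 ≤ Z := tsum_nonneg fun n => by positivity
    have hr : 0 < √s := Real.sqrt_pos.mpr hs
    have hr2 : √s ^ 2 = s := Real.sq_sqrt hs.le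
    have e1 : (s * Z) ^ (-1 / 2 : ℝ) = Z ^ (-1 / 2 : ℝ) / √s := by
      rw [Real.mul_rpow hs.le hZ0, neg_div, Real.rpow_neg hs.le, ← Real.sqrt_eq_rpow]
      ring
    have e2 : (1 / s) ^ (3 / 2 : ℝ) = 1 / √s ^ 3 := by
      rw [Real.div_rpow zero_le_one hs.le, Real.one_rpow, Real.sqrt_eq_rpow, ← Real.rpow_natCast,
        ← Real.rpow_mul hs.le]
      norm_num
    rw [e2] at hsplit
    have e3 : (s * Z) ^ (-1 / 2 : ℝ) - c * (√Real.pi / 2) =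
        √s ^ 3 * ∫ l in Set.Ioi 0, (rieszTau l - c * √l) * Real.exp (-(s * l)) := by
      rw [e1]
      have h5 : ∫ l in Set.Ioi 0, (rieszTau l - c * √l) * Real.exp (-(s * l)) =
        Z ^ (-1 / 2 : ℝ) / s ^ 2 - c * (√Real.pi / 2 * (1 / √s ^ 3)) := by linarith
      rw [h5]
      nth_rw 3 [← hr2]
      field_simp
    rw [e3, abs_mul, abs_of_pos (by positivity : 0 < √s ^ 3)]
    calc _ ≤ √s ^ 3 * (K * (1 / s)) := by gcongr
      _ = √s ^ 3 * (K * (1 / √s ^ 2)) := by rw [hr2]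
      _ = K * √s := by field_simp
  have hlim1 : Tendsto (fun s : ℝ => (s * ∑' n : ℕ, (n : ℝ) ^ (-(1 + s))) ^ (-1 / 2 : ℝ))
      (𝓝[>] 0) (𝓝 1) := by
    have := tendsto_mul_tsum_rpow_neg.rpow_const (p := (-1 / 2 : ℝ)) (Or.inl one_ne_zero)
    rwa [Real.one_rpow] at this
  have hlim2 : Tendsto (fun s : ℝ => (s * ∑' n : ℕ, (n : ℝ) ^ (-(1 + s))) ^ (-1 / 2 : ℝ))
      (𝓝[>] 0) (𝓝 (c * (√Real.pi / 2))) := by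
    rw [tendsto_iff_norm_sub_tendsto_zero]
    have h0 : Tendsto (fun s : ℝ => K * √s) (𝓝[>] 0) (𝓝 0) := by
      have : Tendsto (fun s : ℝ => K * √s) (𝓝 0) (𝓝 (K * √0)) :=
        (Real.continuous_sqrt.const_mul K).tendsto 0
      rw [Real.sqrt_zero, mul_zero] at this
      exact this.mono_left nhdsWithin_le_nhds
    refine squeeze_zero' (Eventually.of_forall fun _ => norm_nonneg _) ?_ h0
    filter_upwards [self_mem_nhdsWithin] with s hs
    exact key s hs
  exact (tendsto_nhds_unique hlim1 hlim2).symm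

/-! ### Summation against smooth weights. -/

open intervalIntegral in
-- Taylor's formula at Y with integral remainder writes h(y) through the ramps Y - y and (r - y)₊;
-- summed over y = log n these become R(Y) and R(r).
theorem sum_divisorTau_mul_eq_integral {h h₁ h₂ : ℝ → ℝ} {Y : ℝ}
    (hd : ∀ y, HasDerivAt h (h₁ y) y) (hd₁ : ∀ y, HasDerivAt h₁ (h₂ y) y) (hc : Continuous h₂)
    (hY : h Y = 0) :
    ∑ n ∈ Finset.Ioc 0 ⌊Real.exp Y⌋₊, divisorTau (-1 / 2) n / n * h (Real.log n) =
      -h₁ Y * rieszTau Y + ∫ r in 0..Y, rieszTau r * h₂ r := by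
  have hc₁ : Continuous h₁ := continuous_iff_continuousAt.mpr fun y => (hd₁ y).continuousAt
  have taylor : ∀ y, h y = -h₁ Y * (Y - y) + ∫ r in y..Y, (r - y) * h₂ r := by
    intro y
    have e1 := integral_mul_deriv_eq_deriv_mul (a := y) (b := Y) (u := fun r => r - y) (v := h₁)
      (u' := fun _ => 1) (v' := h₂) (fun r _ => (hasDerivAt_id r).sub_const y)
      (fun r _ => hd₁ r) (by simp) (hc.intervalIntegrable _ _)
    have e2 := integral_eq_sub_of_hasDerivAt (a := y) (b := Y) (fun r _ => hd r)
      (hc₁.intervalIntegrable _ _)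
    simp only [one_mul] at e1
    rw [e1, e2, hY]
    ring
  have hmax : ∀ y, 0 ≤ y → y ≤ Y →
      ∫ r in y..Y, (r - y) * h₂ r = ∫ r in 0..Y, max (r - y) 0 * h₂ r := by
    intro y hy0 hyY
    have hcm : Continuous fun r => max (r - y) 0 * h₂ r := by fun_prop
    rw [← integral_add_adjacent_intervals (hcm.intervalIntegrable 0 y)
      (hcm.intervalIntegrable y Y)]
    have e1 : ∫ r in 0..y, max (r - y) 0 * h₂ r = ∫ _ in 0..y, (0 : ℝ) := by
      refine integral_congr fun r hr => ?_
      rw [Set.uIcc_of_le hy0] at hr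
      rw [max_eq_right (by linarith [hr.2]), zero_mul]
    rw [e1, integral_zero, zero_add]
    refine integral_congr fun r hr => ?_
    rw [Set.uIcc_of_le hyY] at hr
    rw [max_eq_left (by linarith [hr.1])]
  have e3 : ∑ n ∈ Finset.Ioc 0 ⌊Real.exp Y⌋₊, divisorTau (-1 / 2) n / n * h (Real.log n) =
      ∑ n ∈ Finset.Ioc 0 ⌊Real.exp Y⌋₊, (-h₁ Y * (divisorTau (-1 / 2) n / n * (Y - Real.log n)) +
        ∫ r in 0..Y, divisorTau (-1 / 2) n / n * max (r - Real.log n) 0 * h₂ r) := by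
    refine Finset.sum_congr rfl fun n hn => ?_
    rw [taylor, hmax _ (Real.log_natCast_nonneg n) (log_le_of_mem_Ioc_floor_exp hn)]
    simp_rw [mul_assoc]
    rw [integral_const_mul]
    ring
  rw [e3, Finset.sum_add_distrib, ← Finset.mul_sum, ← rieszTau, ← integral_finsetSum]
  · congr 1
    rcases lt_or_ge Y 0 with hY0 | hY0
    · have h0 : ∀ r ≤ 0, rieszTau r * h₂ r = 0 := by
        intro r hr
        rw [rieszTau]
        rcases hr.lt_or_eq with hr | rfl
        · rw [Nat.floor_eq_zero.mpr (by simpa using hr)]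
          simp
        · simp
      have h1 : ⌊Real.exp Y⌋₊ = 0 := Nat.floor_eq_zero.mpr (by simpa using hY0)
      rw [h1]
      refine integral_congr fun r hr => ?_
      rw [Set.uIcc_of_ge hY0.le] at hr
      simp [h0 r hr.2]
    · refine integral_congr fun r hr => ?_
      rw [Set.uIcc_of_le hY0] at hr
      rw [rieszTau_eq (Nat.floor_le_floor (Real.exp_le_exp.mpr hr.2)), Finset.sum_mul]
  · intro n _
    apply Continuous.intervalIntegrable
    fun_prop

open intervalIntegral in
-- Undoes the second integration by parts in the main term, which then involves only h₁, with the
-- integrable kernel r^(-1/2).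
theorem integral_sqrt_mul_deriv {h₁ h₂ : ℝ → ℝ} {Y : ℝ} (hY : 0 ≤ Y)
    (hd₁ : ∀ y, HasDerivAt h₁ (h₂ y) y) (hc : Continuous h₂) :
    -h₁ Y * √Y + ∫ r in 0..Y, √r * h₂ r =
      -(1 / 2) * ∫ r in 0..Y, r ^ (-(1 / 2) : ℝ) * h₁ r := by
  have hc₁ : Continuous h₁ := continuous_iff_continuousAt.mpr fun y => (hd₁ y).continuousAt
  have e1 := integral_mul_deriv_eq_deriv_mul_of_hasDerivAt (a := 0) (b := Y) (u := fun r => √r)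
    (v := h₁) (u' := fun r => 1 / 2 * r ^ (-(1 / 2) : ℝ)) (v' := h₂)
    Real.continuous_sqrt.continuousOn hc₁.continuousOn
    (fun r hr => by
      rw [min_eq_left hY, max_eq_right hY] at hr
      refine (Real.hasDerivAt_sqrt hr.1.ne').congr_deriv ?_
      rw [Real.rpow_neg hr.1.le, ← Real.sqrt_eq_rpow]
      field_simp)
    (fun r _ => hd₁ r) ((intervalIntegrable_rpow' (by norm_num)).const_mul _)
    (hc.intervalIntegrable _ _)
  simp only [Real.sqrt_zero, zero_mul, sub_zero, mul_assoc, integral_const_mul] at e1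
  rw [e1]
  ring

theorem integral_rpow_neg_half {a b : ℝ} :
    ∫ r in a..b, r ^ (-(1 / 2) : ℝ) = 2 * √b - 2 * √a := by
  rw [integral_rpow (Or.inl (by norm_num)), Real.sqrt_eq_rpow, Real.sqrt_eq_rpow]
  norm_num
  ring

theorem abs_integral_rpow_neg_half_mul_le {g : ℝ → ℝ} {a b M : ℝ} (ha : 0 ≤ a) (hab : a ≤ b)
    (hg : ∀ r ∈ Set.Ioc a b, |g r| ≤ M) :
    |∫ r in a..b, r ^ (-(1 / 2) : ℝ) * g r| ≤ M * (2 * √b - 2 * √a) := by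
  rw [← integral_rpow_neg_half, ← intervalIntegral.integral_const_mul, ← Real.norm_eq_abs]
  refine intervalIntegral.norm_integral_le_of_norm_le hab (Eventually.of_forall fun r hr => ?_)
    ((intervalIntegral.intervalIntegrable_rpow' (by norm_num)).const_mul _)
  have hr0 : 0 < r := ha.trans_lt hr.1
  rw [norm_mul, Real.norm_eq_abs, Real.norm_eq_abs, abs_of_pos (by positivity), mul_comm]
  gcongr
  exact hg r hr

open intervalIntegral in
/-- A Riesz mean asymptotic transfers to sums against a twice differentiable weight vanishing at
the end point. -/
theorem abs_sum_divisorTau_mul_add_le {K : ℝ}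
    (hK : ∀ l : ℝ, |rieszTau l - 2 / √Real.pi * √l| ≤ K)
    {h h₁ h₂ : ℝ → ℝ} {Y B : ℝ} (hY0 : 0 ≤ Y)
    (hd : ∀ y, HasDerivAt h (h₁ y) y) (hd₁ : ∀ y, HasDerivAt h₁ (h₂ y) y) (hc : Continuous h₂)
    (hY : h Y = 0) (hB : ∀ r ∈ Set.Ioc 0 Y, |h₂ r| ≤ B) :
    |∑ n ∈ Finset.Ioc 0 ⌊Real.exp Y⌋₊, divisorTau (-1 / 2) n / n * h (Real.log n) +
      1 / √Real.pi * ∫ r in 0..Y, r ^ (-(1 / 2) : ℝ) * h₁ r| ≤ K * (|h₁ Y| + B * Y) := by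
  have hR : IntervalIntegrable (fun r => (rieszTau r - 2 / √Real.pi * √r) * h₂ r)
      MeasureTheory.volume 0 Y := by
    have h1 : IntervalIntegrable (fun r => rieszTau r - 2 / √Real.pi * √r)
        MeasureTheory.volume 0 Y := by
      refine (intervalIntegrable_const (c := K)).mono_fun' ?_ (Eventually.of_forall fun r => hK r)
      have := measurable_rieszTau
      exact Measurable.aestronglyMeasurable (by fun_prop)
    exact h1.mul_continuousOn hc.continuousOn
  have hS : IntervalIntegrable (fun r => 2 / √Real.pi * (√r * h₂ r)) MeasureTheory.volume 0 Y := by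
    apply Continuous.intervalIntegrable
    fun_prop
  have e1 : ∫ r in 0..Y, rieszTau r * h₂ r =
      (∫ r in 0..Y, (rieszTau r - 2 / √Real.pi * √r) * h₂ r) +
        2 / √Real.pi * ∫ r in 0..Y, √r * h₂ r := by
    rw [← integral_const_mul, ← integral_add hR hS]
    congr 1
    funext r
    ring
  have e2 := integral_sqrt_mul_deriv hY0 hd₁ hc
  have e3 : ∑ n ∈ Finset.Ioc 0 ⌊Real.exp Y⌋₊, divisorTau (-1 / 2) n / n * h (Real.log n) +
      1 / √Real.pi * ∫ r in 0..Y, r ^ (-(1 / 2) : ℝ) * h₁ r =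
      -h₁ Y * (rieszTau Y - 2 / √Real.pi * √Y) +
        ∫ r in 0..Y, (rieszTau r - 2 / √Real.pi * √r) * h₂ r := by
    rw [sum_divisorTau_mul_eq_integral hd hd₁ hc hY, e1]
    linear_combination (2 / √Real.pi) * e2
  rw [e3]
  have hK0 : 0 ≤ K := (abs_nonneg _).trans (hK 0)
  have b1 : |∫ r in 0..Y, (rieszTau r - 2 / √Real.pi * √r) * h₂ r| ≤ K * B * |Y - 0| := by
    rw [← Real.norm_eq_abs]
    refine norm_integral_le_of_norm_le_const fun r hr => ?_
    rw [Set.uIoc_of_le hY0] at hr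
    rw [norm_mul]
    exact mul_le_mul (hK r) (hB r hr) (norm_nonneg _) hK0
  rw [sub_zero, abs_of_nonneg hY0] at b1
  refine (abs_add_le _ _).trans ?_
  rw [abs_mul, abs_neg]
  have b2 := mul_le_mul_of_nonneg_left (hK Y) (abs_nonneg (h₁ Y))
  linarith

theorem hasDerivAt_sub_mul_sin {X b v : ℝ} (hv : v ≠ 0) (y : ℝ) :
    HasDerivAt (fun y => (X - b - y) * (Real.sin (v * (b + y)) / v))
      (-(Real.sin (v * (b + y)) / v) + (X - b - y) * Real.cos (v * (b + y))) y := by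
  have h1 : HasDerivAt (fun y => v * (b + y)) v y := by
    simpa using ((hasDerivAt_id y).const_add b).const_mul v
  have h2 : HasDerivAt (fun y => X - b - y) (-1) y := by
    simpa using (hasDerivAt_id y).const_sub (X - b)
  refine (h2.mul (h1.sin.div_const v)).congr_deriv ?_
  field_simp

theorem hasDerivAt_sub_mul_sin_deriv {X b v : ℝ} (hv : v ≠ 0) (y : ℝ) :
    HasDerivAt
      (fun y => -(Real.sin (v * (b + y)) / v) + (X - b - y) * Real.cos (v * (b + y)))
      (-2 * Real.cos (v * (b + y)) - (X - b - y) * v * Real.sin (v * (b + y))) y := by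
  have h1 : HasDerivAt (fun y => v * (b + y)) v y := by
    simpa using ((hasDerivAt_id y).const_add b).const_mul v
  have h2 : HasDerivAt (fun y => X - b - y) (-1) y := by
    simpa using (hasDerivAt_id y).const_sub (X - b)
  refine ((h1.sin.div_const v).neg.add (h2.mul h1.cos)).congr_deriv ?_
  field_simp
  ring

theorem sin_mul_div_bounds {v t : ℝ} (hv : 0 < v) (ht : 0 ≤ t) (hvt : v * t ≤ 1) :
    0 ≤ Real.sin (v * t) / v ∧ Real.sin (v * t) / v ≤ t := by
  have h0 : 0 ≤ v * t := by positivity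
  constructor
  · exact div_nonneg (Real.sin_nonneg_of_nonneg_of_le_pi h0 (by linarith [Real.pi_gt_three])) hv.le
  · rw [div_le_iff₀ hv, mul_comm t]
    exact Real.sin_le h0

/-- The two terms have opposite signs: since vX ≤ 1, the first lies in [-(b + r), 0] and the second
in [0, X - b - r]. Hence no triangle inequality is lost. -/
theorem abs_sub_mul_sin_deriv_le {X b v r : ℝ} (hv : 0 < v) (hvX : v * X ≤ 1) (hb : 0 ≤ b)
    (hr : 0 ≤ r) (hrX : r ≤ X - b) :
    |-(Real.sin (v * (b + r)) / v) + (X - b - r) * Real.cos (v * (b + r))| ≤ X := by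
  have h0 : 0 ≤ v * (b + r) := by positivity
  have h1 : v * (b + r) ≤ 1 := le_trans (by gcongr; linarith) hvX
  obtain ⟨h2, h3⟩ := sin_mul_div_bounds hv (by linarith : 0 ≤ b + r) h1
  have h4 : 0 ≤ Real.cos (v * (b + r)) :=
    Real.cos_nonneg_of_mem_Icc ⟨by linarith [Real.pi_gt_three], by linarith [Real.pi_gt_three]⟩
  have h5 := Real.cos_le_one (v * (b + r))
  have h6 : 0 ≤ (X - b - r) * Real.cos (v * (b + r)) := mul_nonneg (by linarith) h4
  have h7 : (X - b - r) * Real.cos (v * (b + r)) ≤ X - b - r :=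
    mul_le_of_le_one_right (by linarith) h5
  rw [abs_le]
  constructor <;> linarith

theorem abs_sum_divisorTau_sin_add_le {K : ℝ}
    (hK : ∀ l : ℝ, |rieszTau l - 2 / √Real.pi * √l| ≤ K) {X b v : ℝ} (hv : 0 < v)
    (hvX : v * X ≤ 1) (hb : 0 ≤ b) (hbX : b ≤ X) {N : ℕ} (hN : ⌊Real.exp (X - b)⌋₊ ≤ N) :
    |∑ n ∈ Finset.Ioc 0 N, divisorTau (-1 / 2) n / n *
        (max (X - b - Real.log n) 0 * (Real.sin (v * (b + Real.log n)) / v)) +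
      1 / √Real.pi * ∫ r in 0..(X - b), r ^ (-(1 / 2) : ℝ) *
        (-(Real.sin (v * (b + r)) / v) + (X - b - r) * Real.cos (v * (b + r)))| ≤ K * (4 * X) := by
  have hK0 : 0 ≤ K := (abs_nonneg _).trans (hK 0)
  have hY0 : 0 ≤ X - b := by linarith
  -- The second derivative is at most 2|cos| + |(X - b - r)v| |sin| ≤ 3; with |h₁| ≤ X at the end
  -- point this gives the factor 4X.
  have h := abs_sum_divisorTau_mul_add_le hK (B := 3) hY0
    (hasDerivAt_sub_mul_sin (X := X) (b := b) hv.ne')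
    (hasDerivAt_sub_mul_sin_deriv (X := X) (b := b) hv.ne') (by fun_prop) (by simp) (by
      intro r hr
      have h1 : |(X - b - r) * v| ≤ 1 := by
        rw [abs_of_nonneg (mul_nonneg (by linarith [hr.2]) hv.le), mul_comm]
        refine le_trans ?_ hvX
        have := hr.1.le
        gcongr
        linarith
      have h2 := Real.abs_cos_le_one (v * (b + r))
      have h3 := Real.abs_sin_le_one (v * (b + r))
      refine (abs_sub _ _).trans ?_
      rw [abs_mul, abs_mul _ (Real.sin _), abs_neg, abs_two]
      have h4 : |(X - b - r) * v| * |Real.sin (v * (b + r))| ≤ 1 * 1 :=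
        mul_le_mul h1 h3 (abs_nonneg _) zero_le_one
      linarith)
  have e1 := sum_Ioc_floor_exp_eq (fun n => divisorTau (-1 / 2) n / n *
    (Real.sin (v * (b + Real.log n)) / v)) (X - b) hN one_ne_zero
  simp only [pow_one] at e1
  have e2 : ∑ n ∈ Finset.Ioc 0 N, divisorTau (-1 / 2) n / n *
        (max (X - b - Real.log n) 0 * (Real.sin (v * (b + Real.log n)) / v)) =
      ∑ n ∈ Finset.Ioc 0 ⌊Real.exp (X - b)⌋₊, divisorTau (-1 / 2) n / n *
        ((X - b - Real.log n) * (Real.sin (v * (b + Real.log n)) / v)) := by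
    calc _ = _ := Finset.sum_congr rfl fun n _ => by ring
      _ = _ := e1.symm
      _ = _ := Finset.sum_congr rfl fun n _ => by ring
  rw [e2]
  refine h.trans ?_
  have h5 := abs_sub_mul_sin_deriv_le hv hvX hb hY0 le_rfl
  gcongr
  linarith

theorem le_constC4 {θ : ℝ} (hθ0 : 0 < θ) (hθ1 : θ < 1) :
    1 / √Real.pi * (1 / (1 - θ)) * (3 / 5 + 2 * √(1 - θ)) ≤ constC4 θ := by
  have hpi : 0 < √Real.pi := Real.sqrt_pos.mpr Real.pi_pos
  have h1 : 0 < 1 - θ := by linarith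
  rw [constC4]
  set M := max (3 * √(1 - θ))
        (min (max 1 |1 - 4 * θ| + 3 * θ * √θ) (1 - θ + 3 * θ * √(1 - θ)))
  have hM : 3 * √(1 - θ) ≤ M := le_max_left _ _
  have h2 : 0 ≤ θ ^ (5 / 2 : ℝ) := by positivity
  calc 1 / √Real.pi * (1 / (1 - θ)) * (3 / 5 + 2 * √(1 - θ)) =
        1 / (3 * (1 - θ) * √Real.pi) * (9 / 5 + 6 * √(1 - θ)) := by
        field_simp
        ring
    _ ≤ _ := by
        exact mul_le_mul_of_nonneg_left (by linarith) (by positivity)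

theorem sqrt_difference_bound {A B c : ℝ} (hB : 0 ≤ B) (hc : 0 ≤ c) (hA : 0 ≤ A) (hA1 : A ≤ 1)
    (h : A ^ 2 = B ^ 2 + c ^ 2) : 2 * c ^ 2 * B + 2 * (A - B) ≤ 3 / 5 + 2 * c := by
  have hcA : c ≤ A := abs_le_of_sq_le_sq' (by nlinarith) hA |>.2
  have hAB : A ≤ B + c := abs_le_of_sq_le_sq' (by nlinarith [mul_nonneg hB hc]) (by positivity) |>.2
  have h1 : (A - c) * (1 - c ^ 2) ≤ B * (1 - c ^ 2) := by
    have : 0 ≤ 1 - c ^ 2 := by nlinarith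
    gcongr
    linarith
  have h2 : (A - c) * c ^ 2 ≤ (1 - c) * c ^ 2 := by gcongr
  have h3 : (1 - c) * c ^ 2 ≤ 3 / 10 := by nlinarith [sq_nonneg (c - 2 / 3), mul_nonneg hc (sq_nonneg (c - 2 / 3))]
  linarith

open intervalIntegral in
-- On the common range [0, θL - b] the derivatives differ by just (1 - θ)L cos; on the remaining
-- range the longer ramp's derivative is at most L. Scaling by L reduces the resulting square roots
-- to `sqrt_difference_bound`.
theorem abs_integral_sub_integral_le {θ L b v : ℝ} (hθ1 : θ < 1) (hL : 0 < L)
    (hv : 0 < v) (hvL : v * L ≤ 1) (hb : 0 ≤ b) (hbL : b ≤ θ * L) :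
    |(∫ r in 0..(L - b), r ^ (-(1 / 2) : ℝ) *
        (-(Real.sin (v * (b + r)) / v) + (L - b - r) * Real.cos (v * (b + r)))) -
      ∫ r in 0..(θ * L - b), r ^ (-(1 / 2) : ℝ) *
        (-(Real.sin (v * (b + r)) / v) + (θ * L - b - r) * Real.cos (v * (b + r)))| ≤
      L * √L * (3 / 5 + 2 * √(1 - θ)) := by
  set h₁ : ℝ → ℝ → ℝ := fun X r =>
    -(Real.sin (v * (b + r)) / v) + (X - b - r) * Real.cos (v * (b + r)) with hh
  have hcont : ∀ X, Continuous (h₁ X) := fun X => by simp only [hh]; fun_prop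
  have hint : ∀ X x y, IntervalIntegrable (fun r => r ^ (-(1 / 2) : ℝ) * h₁ X r)
      MeasureTheory.volume x y := fun X x y =>
    (intervalIntegrable_rpow' (by norm_num)).mul_continuousOn (hcont X).continuousOn
  have hθL : θ * L ≤ L := by nlinarith
  have h1θ : 0 < 1 - θ := by linarith
  have e : (∫ r in 0..(L - b), r ^ (-(1 / 2) : ℝ) * h₁ L r) -
      ∫ r in 0..(θ * L - b), r ^ (-(1 / 2) : ℝ) * h₁ (θ * L) r =
      (∫ r in 0..(θ * L - b), r ^ (-(1 / 2) : ℝ) * ((1 - θ) * L * Real.cos (v * (b + r)))) +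
        ∫ r in (θ * L - b)..(L - b), r ^ (-(1 / 2) : ℝ) * h₁ L r := by
    rw [← integral_add_adjacent_intervals (hint L 0 (θ * L - b)) (hint L (θ * L - b) (L - b)),
      add_sub_right_comm, ← integral_sub (hint _ _ _) (hint _ _ _)]
    congr 2
    funext r
    simp only [hh]
    ring
  have b1 : |∫ r in 0..(θ * L - b), r ^ (-(1 / 2) : ℝ) * ((1 - θ) * L * Real.cos (v * (b + r)))| ≤
      (1 - θ) * L * (2 * √(θ * L - b) - 2 * √0) := by
    refine abs_integral_rpow_neg_half_mul_le le_rfl (by linarith) fun r _ => ?_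
    rw [abs_mul, abs_of_pos (by positivity)]
    exact mul_le_of_le_one_right (by positivity) (Real.abs_cos_le_one _)
  have b2 : |∫ r in (θ * L - b)..(L - b), r ^ (-(1 / 2) : ℝ) * h₁ L r| ≤
      L * (2 * √(L - b) - 2 * √(θ * L - b)) := by
    refine abs_integral_rpow_neg_half_mul_le (by linarith) (by linarith) fun r hr => ?_
    exact abs_sub_mul_sin_deriv_le hv hvL hb (by linarith [hr.1]) hr.2
  rw [e]
  refine (abs_add_le _ _).trans ((add_le_add b1 b2).trans ?_)
  have hs : ∀ y, √y = √L * √(y / L) := fun y => by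
    rw [← Real.sqrt_mul hL.le]
    congr 1
    field_simp
  have key := sqrt_difference_bound (A := √((L - b) / L)) (B := √((θ * L - b) / L))
    (c := √(1 - θ)) (Real.sqrt_nonneg _) (Real.sqrt_nonneg _) (Real.sqrt_nonneg _)
    (by rw [Real.sqrt_le_one, div_le_one hL]; linarith)
    (by
      rw [Real.sq_sqrt (div_nonneg (by linarith) hL.le),
        Real.sq_sqrt (div_nonneg (by linarith) hL.le), Real.sq_sqrt h1θ.le]
      field_simp
      ring)
  rw [Real.sq_sqrt h1θ.le] at key
  rw [Real.sqrt_zero, hs (θ * L - b), hs (L - b)]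
  calc _ = L * √L * (2 * (1 - θ) * √((θ * L - b) / L) +
        2 * (√((L - b) / L) - √((θ * L - b) / L))) := by ring
    _ ≤ _ := by gcongr

theorem abs_sum_divisorTau_mollified_le {K : ℝ}
    (hK : ∀ l : ℝ, |rieszTau l - 2 / √Real.pi * √l| ≤ K) {θ L b v : ℝ} (hθ0 : 0 < θ)
    (hθ1 : θ < 1) (hL : 0 < L) (hv : 0 < v) (hvL : v * L ≤ 1) (hb : 0 ≤ b) {N : ℕ}
    (hN : ⌊Real.exp L⌋₊ ≤ N) :
    |∑ n ∈ Finset.Ioc 0 N, divisorTau (-1 / 2) n / n *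
        (1 / ((1 - θ) * L) * (max (L - b - Real.log n) 0 - max (θ * L - b - Real.log n) 0) *
          (Real.sin (v * (b + Real.log n)) / v))| ≤
      constC4 θ * √L + 8 * K / (1 - θ) := by
  have hK0 : 0 ≤ K := (abs_nonneg _).trans (hK 0)
  have hθL : θ * L ≤ L := by nlinarith
  have hθL0 : 0 < θ * L := by positivity
  have h1θ : 0 < 1 - θ := by linarith
  have hpi : 0 < √Real.pi := Real.sqrt_pos.mpr Real.pi_pos
  have hsL : 0 < √L := Real.sqrt_pos.mpr hL
  have hC := le_constC4 hθ0 hθ1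
  have hfl : ∀ X ≤ L, ⌊Real.exp (X - b)⌋₊ ≤ N := fun X hX =>
    (Nat.floor_le_floor (Real.exp_le_exp.mpr (by linarith))).trans hN
  set S : ℝ → ℝ := fun X => ∑ n ∈ Finset.Ioc 0 N, divisorTau (-1 / 2) n / n *
        (max (X - b - Real.log n) 0 * (Real.sin (v * (b + Real.log n)) / v)) with hS
  have hS0 : ∀ X ≤ b, S X = 0 := by
    intro X hX
    refine Finset.sum_eq_zero fun n _ => ?_
    have := Real.log_natCast_nonneg n
    rw [max_eq_right (by linarith)]
    ring
  have e : ∑ n ∈ Finset.Ioc 0 N, divisorTau (-1 / 2) n / n *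
        (1 / ((1 - θ) * L) * (max (L - b - Real.log n) 0 - max (θ * L - b - Real.log n) 0) *
          (Real.sin (v * (b + Real.log n)) / v)) = 1 / ((1 - θ) * L) * (S L - S (θ * L)) := by
    simp only [hS]
    rw [← Finset.sum_sub_distrib, Finset.mul_sum]
    exact Finset.sum_congr rfl fun n _ => by ring
  rw [e, abs_mul, abs_of_pos (by positivity)]
  suffices h : |S L - S (θ * L)| ≤ 1 / √Real.pi * (L * √L * (3 / 5 + 2 * √(1 - θ))) + K * (8 * L) by
    calc 1 / ((1 - θ) * L) * |S L - S (θ * L)| ≤ 1 / ((1 - θ) * L) *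
          (1 / √Real.pi * (L * √L * (3 / 5 + 2 * √(1 - θ))) + K * (8 * L)) := by gcongr
      _ = 1 / √Real.pi * (1 / (1 - θ)) * (3 / 5 + 2 * √(1 - θ)) * √L + 8 * K / (1 - θ) := by
          field_simp
      _ ≤ _ := by gcongr
  -- Later shifts make b arbitrary: both ramps are active for b ≤ θL, only the longer one for θL ≤ b
  -- ≤ L, and none beyond L.
  rcases le_total b (θ * L) with hbθ | hbθ
  · have h1 := abs_sum_divisorTau_sin_add_le hK hv hvL hb (hbθ.trans hθL) (hfl L le_rfl)
    have h2 := abs_sum_divisorTau_sin_add_le hK hv (X := θ * L)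
      (le_trans (by gcongr) hvL) hb hbθ (hfl _ hθL)
    have h3 := abs_integral_sub_integral_le hθ1 hL hv hvL hb hbθ
    set I₁ := ∫ r in 0..(L - b), r ^ (-(1 / 2) : ℝ) *
        (-(Real.sin (v * (b + r)) / v) + (L - b - r) * Real.cos (v * (b + r)))
    set I₂ := ∫ r in 0..(θ * L - b), r ^ (-(1 / 2) : ℝ) *
        (-(Real.sin (v * (b + r)) / v) + (θ * L - b - r) * Real.cos (v * (b + r)))
    change |S L + 1 / √Real.pi * I₁| ≤ _ at h1
    change |S (θ * L) + 1 / √Real.pi * I₂| ≤ _ at h2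
    have h4 : |1 / √Real.pi * (I₁ - I₂)| ≤
        1 / √Real.pi * (L * √L * (3 / 5 + 2 * √(1 - θ))) := by
      rw [abs_mul, abs_of_pos (by positivity)]
      gcongr
    have h5 : K * (4 * (θ * L)) ≤ K * (4 * L) := by gcongr
    rw [abs_le] at h1 h2 h4 ⊢
    constructor <;> linarith
  · rw [hS0 _ hbθ, sub_zero]
    rcases le_total b L with hbL | hbL
    · have h1 := abs_sum_divisorTau_sin_add_le hK hv hvL hb hbL (hfl L le_rfl)
      have h3 : |∫ r in 0..(L - b), r ^ (-(1 / 2) : ℝ) *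
          (-(Real.sin (v * (b + r)) / v) + (L - b - r) * Real.cos (v * (b + r)))| ≤
          L * (2 * √(L - b) - 2 * √0) :=
        abs_integral_rpow_neg_half_mul_le le_rfl (by linarith) fun r hr =>
          abs_sub_mul_sin_deriv_le hv hvL hb hr.1.le hr.2
      set I₁ := ∫ r in 0..(L - b), r ^ (-(1 / 2) : ℝ) *
        (-(Real.sin (v * (b + r)) / v) + (L - b - r) * Real.cos (v * (b + r)))
      change |S L + 1 / √Real.pi * I₁| ≤ _ at h1
      have h6 : √(L - b) ≤ √L * √(1 - θ) := by
        rw [← Real.sqrt_mul hL.le]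
        exact Real.sqrt_le_sqrt (by linarith)
      have h4 : |1 / √Real.pi * I₁| ≤
          1 / √Real.pi * (L * √L * (3 / 5 + 2 * √(1 - θ))) := by
        rw [abs_mul, abs_of_pos (by positivity)]
        gcongr
        refine h3.trans ?_
        rw [Real.sqrt_zero, mul_assoc]
        gcongr
        linarith
      have h5 : 0 ≤ K * (4 * L) := by positivity
      rw [abs_le] at h1 h4 ⊢
      constructor <;> linarith
    · rw [hS0 _ hbL, abs_zero]
      positivity

/-! ### Imposing coprimality one prime at a time. -/

theorem sum_Ioc_mul_left_eq {f a : ℕ → ℝ} {N j : ℕ} (hj : 0 < j) (hf : ∀ n, N < n → f n = 0) :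
    ∑ m ∈ Finset.Ioc 0 N, a m * f (j * m) =
      ∑ n ∈ Finset.Ioc 0 N, if j ∣ n then a (n / j) * f n else 0 := by
  have h1 : ∑ m ∈ Finset.Ioc 0 N, a m * f (j * m) =
      ∑ m ∈ Finset.Ioc 0 (N / j), a m * f (j * m) := by
    refine (Finset.sum_subset (Finset.Ioc_subset_Ioc_right (Nat.div_le_self N j)) ?_).symm
    intro m hm hm'
    rw [Finset.mem_Ioc] at hm hm'
    rw [hf, mul_zero]
    by_contra h
    exact hm' ⟨hm.1, (Nat.le_div_iff_mul_le hj).mpr (by rw [mul_comm]; omega)⟩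
  rw [h1, ← Finset.sum_filter]
  refine Finset.sum_nbij' (fun m => j * m) (fun n => n / j) ?_ ?_ ?_ ?_ ?_
  · intro m hm
    rw [Finset.mem_Ioc, Nat.le_div_iff_mul_le hj, mul_comm] at hm
    exact Finset.mem_filter.mpr ⟨Finset.mem_Ioc.mpr ⟨Nat.mul_pos hj hm.1, hm.2⟩, dvd_mul_right _ _⟩
  · intro n hn
    rw [Finset.mem_filter, Finset.mem_Ioc] at hn
    exact Finset.mem_Ioc.mpr ⟨Nat.div_pos (Nat.le_of_dvd hn.1.1 hn.2) hj,
      Nat.div_le_div_right hn.1.2⟩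
  · intro m _
    exact Nat.mul_div_cancel_left m hj
  · intro n hn
    exact Nat.mul_div_cancel' (Finset.mem_filter.mp hn).2
  · intro m _
    simp only [Nat.mul_div_cancel_left m hj]

/-- The coefficient `τ_{-1/2}(n) / n` restricted to `n` without prime factors in `S`. -/
noncomputable def coprimeTau (S : Finset ℕ) (n : ℕ) : ℝ :=
  open Classical in
  if ∀ p ∈ S, ¬ p ∣ n then divisorTau (-1 / 2) n / n else 0

theorem coprimeTau_prime_pow_mul {S : Finset ℕ} (hS : ∀ p ∈ S, p.Prime) {p : ℕ} (hp : p.Prime)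
    (hpS : p ∉ S) {m : ℕ} (hpm : ¬ p ∣ m) (k : ℕ) :
    coprimeTau S (p ^ k * m) = divisorTauCoeff (-1 / 2) k / (p : ℝ) ^ k * coprimeTau S m := by
  have h1 : (∀ r ∈ S, ¬ r ∣ p ^ k * m) ↔ ∀ r ∈ S, ¬ r ∣ m := by
    refine forall₂_congr fun r hr => not_congr ⟨fun h => ?_, fun h => h.mul_left _⟩
    refine ((hS r hr).dvd_mul.mp h).resolve_left fun h => ?_
    exact hpS ((Nat.prime_dvd_prime_iff_eq (hS r hr) hp).mp ((hS r hr).dvd_of_dvd_pow h) ▸ hr)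
  have h2 : (p ^ k).Coprime m := ((Nat.Prime.coprime_iff_not_dvd hp).mpr hpm).pow_left k
  unfold coprimeTau
  simp only [h1]
  split_ifs
  · rw [divisorTau_mul _ h2, divisorTau_prime_pow _ hp]
    push_cast
    rw [mul_div_mul_comm]
  · simp

/-- Multiplying the Dirichlet series by the Euler factor of ζ^(1/2) at p cancels the factor of
ζ^(-1/2) there. -/
theorem coprimeTau_insert {S : Finset ℕ} (hS : ∀ p ∈ S, p.Prime) {p : ℕ} (hp : p.Prime)
    (hpS : p ∉ S) {n K : ℕ} (hn : 0 < n) (hnK : n < K) :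
    ∑ k ∈ Finset.range K, divisorTauCoeff (1 / 2) k / (p : ℝ) ^ k *
      (if p ^ k ∣ n then coprimeTau S (n / p ^ k) else 0) = coprimeTau (insert p S) n := by
  obtain ⟨v, m, hpm, rfl⟩ := Nat.exists_eq_pow_mul_and_not_dvd hn.ne' p hp.ne_one
  have hm0 : 0 < m := Nat.pos_of_ne_zero fun h => hpm (h ▸ dvd_zero p)
  -- K > n suffices to include every exponent up to v, because v < p^v ≤ n.
  have hvK : v < K :=
    (Nat.lt_pow_self hp.one_lt).trans ((Nat.le_mul_of_pos_right _ hm0).trans_lt hnK)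
  have hp0 : (p : ℝ) ≠ 0 := by exact_mod_cast hp.ne_zero
  have hdvd : ∀ k, p ^ k ∣ p ^ v * m ↔ k ≤ v := by
    intro k
    refine ⟨fun h => ?_, fun h => (pow_dvd_pow p h).mul_right m⟩
    by_contra hk
    have h2 : p ^ v * p ∣ p ^ v * m := by
      rw [← pow_succ]
      exact (pow_dvd_pow p (by omega)).trans h
    exact hpm ((Nat.mul_dvd_mul_iff_left (pow_pos hp.pos v)).mp h2)
  have h1 : ∑ k ∈ Finset.range K, divisorTauCoeff (1 / 2) k / (p : ℝ) ^ k *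
      (if p ^ k ∣ p ^ v * m then coprimeTau S (p ^ v * m / p ^ k) else 0) =
      ∑ k ∈ Finset.range (v + 1), divisorTauCoeff (1 / 2) k * divisorTauCoeff (-(1 / 2)) (v - k) *
        (coprimeTau S m / (p : ℝ) ^ v) := by
    rw [← Finset.sum_subset (Finset.range_mono hvK)]
    · refine Finset.sum_congr rfl fun k hk => ?_
      have hkv : k ≤ v := by rw [Finset.mem_range] at hk; omega
      have e : p ^ v * m = p ^ k * (p ^ (v - k) * m) := by
        rw [← mul_assoc, ← pow_add, Nat.add_sub_cancel' hkv]
      rw [if_pos ((hdvd k).mpr hkv), e, Nat.mul_div_cancel_left _ (pow_pos hp.pos k),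
        coprimeTau_prime_pow_mul hS hp hpS hpm, neg_div]
      have e2 : (p : ℝ) ^ v = (p : ℝ) ^ k * (p : ℝ) ^ (v - k) := by
        rw [← pow_add, Nat.add_sub_cancel' hkv]
      rw [e2]
      field_simp
    · intro k _ hk
      rw [Finset.mem_range] at hk
      rw [if_neg (by rw [hdvd]; omega), mul_zero]
  rw [h1, ← Finset.sum_mul, sum_divisorTauCoeff_mul]
  split_ifs with hv
  · subst hv
    simp only [pow_zero, one_mul, div_one]
    unfold coprimeTau
    simp [hpm]
  · rw [zero_mul, coprimeTau, if_neg]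
    intro h
    exact h p (Finset.mem_insert_self p S) ((dvd_pow_self p hv).mul_right m)

theorem one_sub_inv_prime_pos {p : ℕ} (hp : p.Prime) : 0 < 1 - (p : ℝ)⁻¹ := by
  have : (1 : ℝ) < p := by exact_mod_cast hp.one_lt
  have := inv_lt_one_of_one_lt₀ this
  linarith

/-- A bound uniform in translations survives imposing a coprimality condition, at the cost of the
Euler factors of `ζ(1) ^ (1/2)`. -/
theorem abs_sum_coprimeTau_le {F : ℝ → ℝ} {L B : ℝ} (hF : ∀ y, L ≤ y → F y = 0)
    (hB : ∀ b, 0 ≤ b → |∑ n ∈ Finset.Ioc 0 ⌊Real.exp L⌋₊,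
      divisorTau (-1 / 2) n / n * F (b + Real.log n)| ≤ B)
    (S : Finset ℕ) (hS : ∀ p ∈ S, p.Prime) (b : ℝ) (hb : 0 ≤ b) :
    |∑ n ∈ Finset.Ioc 0 ⌊Real.exp L⌋₊, coprimeTau S n * F (b + Real.log n)| ≤
      (∏ p ∈ S, (1 - (p : ℝ)⁻¹) ^ (-(1 / 2) : ℝ)) * B := by
  have hB0 : 0 ≤ B := (abs_nonneg _).trans (hB 0 le_rfl)
  set N := ⌊Real.exp L⌋₊ with hN
  induction S using Finset.induction_on generalizing b with
  | empty =>
    refine le_trans (le_of_eq ?_) ((hB b hb).trans_eq (by simp))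
    simp [coprimeTau]
  | insert p S hpS ih =>
    have hp : p.Prime := hS p (Finset.mem_insert_self p S)
    have hS' : ∀ r ∈ S, r.Prime := fun r hr => hS r (Finset.mem_insert_of_mem hr)
    have hp0 : (0 : ℝ) < p := by exact_mod_cast hp.pos
    have hp1 : (1 : ℝ) < p := by exact_mod_cast hp.one_lt
    have hf : ∀ n, N < n → F (b + Real.log n) = 0 := fun n hn =>
      hF _ (by linarith [le_log_of_floor_exp_lt hn])
    -- Writing n = p^k m turns the convolution into a nonnegative combination of sums for S with
    -- shift b + k log p. Their truncation at N is harmless since F vanishes from L on.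
    have e : ∑ n ∈ Finset.Ioc 0 N, coprimeTau (insert p S) n * F (b + Real.log n) =
        ∑ k ∈ Finset.range (N + 1), divisorTauCoeff (1 / 2) k / (p : ℝ) ^ k *
          ∑ m ∈ Finset.Ioc 0 N, coprimeTau S m * F (b + k * Real.log p + Real.log m) := by
      have e1 : ∀ k ∈ Finset.range (N + 1), divisorTauCoeff (1 / 2) k / (p : ℝ) ^ k *
          ∑ m ∈ Finset.Ioc 0 N, coprimeTau S m * F (b + k * Real.log p + Real.log m) =
          ∑ n ∈ Finset.Ioc 0 N, divisorTauCoeff (1 / 2) k / (p : ℝ) ^ k *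
            (if p ^ k ∣ n then coprimeTau S (n / p ^ k) else 0) * F (b + Real.log n) := by
        intro k _
        have e2 : ∑ m ∈ Finset.Ioc 0 N, coprimeTau S m * F (b + k * Real.log p + Real.log m) =
            ∑ m ∈ Finset.Ioc 0 N, coprimeTau S m * F (b + Real.log ((p ^ k * m : ℕ) : ℝ)) := by
          refine Finset.sum_congr rfl fun m hm => ?_
          have hm0 : (m : ℝ) ≠ 0 := by exact_mod_cast (Finset.mem_Ioc.mp hm).1.ne'
          rw [Nat.cast_mul, Nat.cast_pow, Real.log_mul (by positivity) hm0, Real.log_pow, add_assoc]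
        rw [e2, sum_Ioc_mul_left_eq (f := fun n => F (b + Real.log n)) (pow_pos hp.pos k) hf,
          Finset.mul_sum]
        refine Finset.sum_congr rfl fun n _ => ?_
        split_ifs <;> ring
      rw [Finset.sum_congr rfl e1, Finset.sum_comm]
      refine Finset.sum_congr rfl fun n hn => ?_
      rw [Finset.mem_Ioc] at hn
      rw [← Finset.sum_mul, coprimeTau_insert hS' hp hpS hn.1 (by omega)]
    have hsum := hasSum_divisorTauCoeff (1 / 2) (inv_nonneg.mpr hp0.le) (inv_lt_one_of_one_lt₀ hp1)
    have hle : ∑ k ∈ Finset.range (N + 1), divisorTauCoeff (1 / 2) k / (p : ℝ) ^ k ≤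
        (1 - (p : ℝ)⁻¹) ^ (-(1 / 2) : ℝ) := by
      refine le_trans (le_of_eq ?_) (sum_le_hasSum (Finset.range (N + 1)) (fun k _ => mul_nonneg
        (divisorTauCoeff_nonneg (by norm_num) k) (by positivity)) hsum)
      exact Finset.sum_congr rfl fun k _ => by rw [inv_pow, div_eq_mul_inv]
    set P := ∏ p ∈ S, (1 - (p : ℝ)⁻¹) ^ (-(1 / 2) : ℝ) with hP
    have hP0 : 0 ≤ P := Finset.prod_nonneg fun r hr =>
      Real.rpow_nonneg (one_sub_inv_prime_pos (hS' r hr)).le _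
    rw [e, Finset.prod_insert hpS]
    refine (Finset.abs_sum_le_sum_abs _ _).trans ?_
    calc _ ≤ ∑ k ∈ Finset.range (N + 1), divisorTauCoeff (1 / 2) k / (p : ℝ) ^ k * (P * B) := by
          refine Finset.sum_le_sum fun k _ => ?_
          have h1 : 0 ≤ divisorTauCoeff (1 / 2) k / (p : ℝ) ^ k :=
            div_nonneg (divisorTauCoeff_nonneg (by norm_num) k) (by positivity)
          rw [abs_mul, abs_of_nonneg h1]
          have h2 : 0 ≤ Real.log p := Real.log_natCast_nonneg p
          exact mul_le_mul_of_nonneg_left (ih hS' _ (by positivity)) h1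
      _ ≤ _ := by
          rw [← Finset.sum_mul, mul_assoc]
          gcongr

/-- With x = 1/p ≤ 1/2, (1 - x)(1 + x)² = 1 + x(1 - x - x²) ≥ 1, so even 1 + 1/p is an upper bound.
-/
theorem one_sub_inv_prime_rpow_le {p : ℕ} (hp : p.Prime) :
    (1 - (p : ℝ)⁻¹) ^ (-(1 / 2) : ℝ) ≤ 1 + (p : ℝ) ^ (-(3 / 4) : ℝ) := by
  have hp2 : (2 : ℝ) ≤ p := by exact_mod_cast hp.two_le
  have hpos := one_sub_inv_prime_pos hp
  have h1 : (p : ℝ)⁻¹ ≤ (p : ℝ) ^ (-(3 / 4) : ℝ) := by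
    rw [← Real.rpow_neg_one]
    exact Real.rpow_le_rpow_of_exponent_le (by linarith) (by norm_num)
  have h2 : (p : ℝ)⁻¹ ≤ 2⁻¹ := by gcongr
  have h3 : 0 < (p : ℝ)⁻¹ := by positivity
  refine le_trans ?_ (add_le_add_right h1 1)
  set x := (p : ℝ)⁻¹
  rw [Real.rpow_neg hpos.le, ← Real.sqrt_eq_rpow, inv_le_comm₀ (Real.sqrt_pos.mpr hpos)
    (by positivity), Real.le_sqrt (by positivity) hpos.le, inv_pow,
    inv_le_iff_one_le_mul₀ (by positivity)]
  have : (1 - x) * (1 + x) ^ 2 = 1 + x * (1 - x - x ^ 2) := by ring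
  rw [this]
  have : 0 ≤ x * (1 - x - x ^ 2) := mul_nonneg h3.le (by nlinarith)
  linarith

theorem prod_one_sub_inv_rpow {D : ℕ} (hD : 0 < D) :
    ∏ p ∈ D.primeFactors, (1 - (p : ℝ)⁻¹) ^ (-(1 / 2) : ℝ) = √((D : ℝ) / Nat.totient D) := by
  have h0 : ∀ p ∈ D.primeFactors, 0 ≤ 1 - (p : ℝ)⁻¹ := fun p hp =>
    (one_sub_inv_prime_pos (Nat.prime_of_mem_primeFactors hp)).le
  have h1 : (Nat.totient D : ℝ) = D * ∏ p ∈ D.primeFactors, (1 - (p : ℝ)⁻¹) := by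
    have h := congrArg (Rat.cast : ℚ → ℝ) (Nat.totient_eq_mul_prod_factors D)
    push_cast at h
    exact h
  have hD0 : (D : ℝ) ≠ 0 := by exact_mod_cast hD.ne'
  rw [Real.finsetProd_rpow _ _ h0, Real.rpow_neg (Finset.prod_nonneg h0), ← Real.sqrt_eq_rpow, h1,
    ← Real.sqrt_inv]
  congr 1
  field_simp

/-! ### Assembly. -/

theorem mollWeight_eq {θ ξ x : ℝ} (hθ1 : θ < 1) (hξ : 1 < ξ) (hx : 0 < x) :
    mollWeight θ ξ x = 1 / ((1 - θ) * Real.log ξ) *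
      (max (Real.log ξ - Real.log x) 0 - max (θ * Real.log ξ - Real.log x) 0) := by
  have hξ0 : 0 < ξ := by linarith
  have hL : 0 < Real.log ξ := Real.log_pos hξ
  have h1θ : (1 - θ) ≠ 0 := by linarith
  have hθL : θ * Real.log ξ ≤ Real.log ξ := by nlinarith
  have h1 : x ≤ ξ ^ θ ↔ Real.log x ≤ θ * Real.log ξ := by
    rw [← Real.log_rpow hξ0, Real.log_le_log_iff hx (by positivity)]
  have h2 : x ≤ ξ ↔ Real.log x ≤ Real.log ξ := (Real.log_le_log_iff hx hξ0).symm
  unfold mollWeight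
  simp only [h1, h2]
  split_ifs with ha hb
  · rw [max_eq_left (by linarith), max_eq_left (by linarith)]
    field_simp
    ring
  · rw [max_eq_left (by linarith), max_eq_right (by linarith),
      Real.log_div hξ0.ne' hx.ne']
    field_simp
    ring
  · rw [max_eq_right (by linarith), max_eq_right (by linarith)]
    ring

/-- As the primes of δ divide d, every admissible n is coprime to δ, so τ_{-1/2}(δ) factors out and
δ survives only as the shift log δ. -/
theorem sineSum_eq {θ L v : ℝ} (hθ1 : θ < 1) (hL : 0 < L) {q d δ : ℕ} (hq : 0 < q) (hd : 0 < d)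
    (hδ : 0 < δ) (hδd : DvdInfty δ d) :
    sineSum θ (Real.exp L) q d δ v = divisorTau (-1 / 2) δ *
      ∑ n ∈ Finset.Ioc 0 ⌊Real.exp L⌋₊, coprimeTau (q * d).primeFactors n *
        (1 / ((1 - θ) * L) * (max (L - (Real.log δ + Real.log n)) 0 -
          max (θ * L - (Real.log δ + Real.log n)) 0) *
          (Real.sin (v * (Real.log δ + Real.log n)) / v)) := by
  have hξ : 1 < Real.exp L := Real.one_lt_exp_iff.mpr hL
  rw [sineSum, tsum_eq_sum (s := Finset.Ioc 0 ⌊Real.exp L⌋₊), Finset.mul_sum]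
  · refine Finset.sum_congr rfl fun n hn => ?_
    have hn0 : 0 < n := (Finset.mem_Ioc.mp hn).1
    have hnR : (0 : ℝ) < n := by exact_mod_cast hn0
    have hδR : (0 : ℝ) < δ := by exact_mod_cast hδ
    have hcop : (1 ≤ n ∧ Nat.Coprime n (q * d)) ↔ ∀ p ∈ (q * d).primeFactors, ¬ p ∣ n := by
      constructor
      · rintro ⟨-, h⟩ p hp hpn
        exact Nat.not_coprime_of_dvd_of_dvd (Nat.prime_of_mem_primeFactors hp).one_lt hpn
          (Nat.dvd_of_mem_primeFactors hp) h
      · intro h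
        refine ⟨hn0, Nat.coprime_of_dvd fun p hp hpn hpd => ?_⟩
        exact h p (Nat.mem_primeFactors.mpr ⟨hp, hpd, (Nat.mul_pos hq hd).ne'⟩) hpn
    unfold sineSumTerm coprimeTau
    simp only [hcop]
    split_ifs with h
    · have hnδ : n.Coprime δ := Nat.coprime_of_dvd fun p hp hpn hpδ =>
        h p (Nat.mem_primeFactors.mpr ⟨hp, (hδd p hp hpδ).mul_left q, (Nat.mul_pos hq hd).ne'⟩) hpn
      have hnδR : (0 : ℝ) < ((n * δ : ℕ) : ℝ) := by exact_mod_cast Nat.mul_pos hn0 hδ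
      rw [mollWeight_eq hθ1 hξ hnδR, divisorTau_mul _ hnδ, Real.log_exp, Nat.cast_mul,
        Real.log_mul hnR.ne' hδR.ne', add_comm (Real.log n)]
      ring
    · ring
  · intro n hn
    rcases Nat.eq_zero_or_pos n with rfl | hn0
    · simp [sineSumTerm]
    · refine sineSumTerm_eq_zero hθ1 hξ hδ v (Nat.lt_of_floor_lt ?_)
      by_contra h
      exact hn (Finset.mem_Ioc.mpr ⟨hn0, not_lt.mp h⟩)

theorem abs_sineSum_le {K : ℝ} (hK : ∀ l : ℝ, |rieszTau l - 2 / √Real.pi * √l| ≤ K)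
    {θ L v : ℝ} (hθ0 : 0 < θ) (hθ1 : θ < 1) (hL : 0 < L) (hv : 0 < v) (hvL : v ≤ 1 / L)
    {q d δ : ℕ} (hq : 0 < q) (hd : 0 < d) (hδ : 0 < δ) (hδd : DvdInfty δ d) :
    |sineSum θ (Real.exp L) q d δ v| ≤ divisorTau (1 / 2) δ *
      ((∏ p ∈ (q * d).primeFactors, (1 - (p : ℝ)⁻¹) ^ (-(1 / 2) : ℝ)) *
        (constC4 θ * √L + 8 * K / (1 - θ))) := by
  rw [sineSum_eq hθ1 hL hq hd hδ hδd, abs_mul]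
  refine mul_le_mul (abs_divisorTau_neg_half_le δ) ?_ (abs_nonneg _)
    (divisorTau_nonneg (by norm_num) δ)
  refine abs_sum_coprimeTau_le (F := fun y => 1 / ((1 - θ) * L) * (max (L - y) 0 -
    max (θ * L - y) 0) * (Real.sin (v * y) / v)) (fun y hy => ?_) (fun b hb => ?_) _
    (fun p hp => Nat.prime_of_mem_primeFactors hp) _ (Real.log_natCast_nonneg δ)
  · have : θ * L ≤ L := by nlinarith
    rw [max_eq_right (by linarith), max_eq_right (by linarith)]
    ring
  · have := abs_sum_divisorTau_mollified_le hK hθ0 hθ1 hL hv ((le_div_iff₀ hL).mp hvL) hb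
      (le_refl ⌊Real.exp L⌋₊)
    simp only [sub_sub] at this
    exact this

theorem prod_primeFactors_mul_le {q d : ℕ} (hdq : d.Coprime q) :
    ∏ p ∈ (q * d).primeFactors, (1 - (p : ℝ)⁻¹) ^ (-(1 / 2) : ℝ) ≤
      (∏ p ∈ q.primeFactors, (1 - (p : ℝ)⁻¹) ^ (-(1 / 2) : ℝ)) *
        ∏ p ∈ d.primeFactors, (1 + (p : ℝ) ^ (-(3 / 4) : ℝ)) := by
  have hnn : ∀ m : ℕ, ∀ p ∈ m.primeFactors, 0 ≤ (1 - (p : ℝ)⁻¹) ^ (-(1 / 2) : ℝ) := fun m p hp =>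
    Real.rpow_nonneg (one_sub_inv_prime_pos (Nat.prime_of_mem_primeFactors hp)).le _
  rw [hdq.symm.primeFactors_mul, Finset.prod_union hdq.symm.disjoint_primeFactors]
  refine mul_le_mul_of_nonneg_left ?_ (Finset.prod_nonneg (hnn q))
  exact Finset.prod_le_prod (hnn d) fun p hp =>
    one_sub_inv_prime_rpow_le (Nat.prime_of_mem_primeFactors hp)

theorem mainTheorem8 (θ κ : ℝ) (hθ0 : 0 < θ) (hθ1 : θ < 1) (hκ : 0 < κ) (q : ℕ) (hq : 1 ≤ q) :
    ∃ (C : ℝ) (ω : ℝ → ℝ), Tendsto ω atTop (𝓝 0) ∧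
      ∀ᶠ T : ℝ in atTop, ∀ (d δ : ℕ) (v : ℝ),
        1 ≤ d → Nat.Coprime d q → 1 ≤ δ → (δ : ℝ) ≤ T ^ κ → DvdInfty δ d →
        0 < v → v ≤ 1 / Real.log (T ^ κ) →
        |sineSum θ (T ^ κ) q d δ v| ≤
          (1 + ω T) * (constC4 θ * divisorTau (1 / 2) δ *
            √(((d : ℝ) * q) / ((Nat.totient d : ℝ) * Nat.totient q)) *
            (Real.log (T ^ κ)) ^ (1 / 2 : ℝ))
          + C * (divisorTau (1 / 2) δ *
            (∏ p ∈ d.primeFactors, (1 + (p : ℝ) ^ (-(3 / 4) : ℝ))) *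
            (Real.log T) ^ (1 / 3 : ℝ)) := by
  obtain ⟨K, hK0, hK⟩ := abs_rieszTau_sub_le
  set Q := ∏ p ∈ q.primeFactors, (1 - (p : ℝ)⁻¹) ^ (-(1 / 2) : ℝ) with hQ
  have hQ0 : 0 ≤ Q := Finset.prod_nonneg fun p hp =>
    Real.rpow_nonneg (one_sub_inv_prime_pos (Nat.prime_of_mem_primeFactors hp)).le _
  have h1θ : 0 < 1 - θ := by linarith
  -- The secondary term is bounded apart from the arithmetic factors, so ω = 0 works. C absorbs the
  -- primes of q, and T ≥ e makes (log T)^(1/3) ≥ 1.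
  refine ⟨Q * (8 * K / (1 - θ)), fun _ => 0, tendsto_const_nhds, ?_⟩
  filter_upwards [eventually_ge_atTop (Real.exp 1)] with T hT d δ v hd hdq hδ _ hδd hv hvL
  have hT0 : 0 < T := (Real.exp_pos 1).trans_le hT
  have hlogT : 1 ≤ Real.log T := (Real.le_log_iff_exp_le hT0).mpr hT
  set L := Real.log (T ^ κ) with hL
  have hL0 : 0 < L := by
    rw [hL, Real.log_rpow hT0]
    positivity
  have hexp : T ^ κ = Real.exp L := by rw [hL, Real.exp_log (by positivity)]
  have h := abs_sineSum_le hK hθ0 hθ1 hL0 hv hvL hq hd hδ hδd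
  have hprod := prod_primeFactors_mul_le hdq
  rw [← hQ] at hprod
  set P := ∏ p ∈ d.primeFactors, (1 + (p : ℝ) ^ (-(3 / 4) : ℝ)) with hP
  have hP0 : 0 ≤ P := Finset.prod_nonneg fun p _ => by positivity
  have hτ := divisorTau_nonneg (by norm_num : (0 : ℝ) ≤ 1 / 2) δ
  have hlog3 : 1 ≤ Real.log T ^ (1 / 3 : ℝ) := Real.one_le_rpow hlogT (by norm_num)
  have hsqrt : ∏ p ∈ (q * d).primeFactors, (1 - (p : ℝ)⁻¹) ^ (-(1 / 2) : ℝ) =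
      √(((d : ℝ) * q) / ((Nat.totient d : ℝ) * Nat.totient q)) := by
    rw [prod_one_sub_inv_rpow (Nat.mul_pos hq hd), Nat.totient_mul hdq.symm]
    push_cast
    rw [mul_comm (d : ℝ), mul_comm (Nat.totient d : ℝ)]
  rw [hexp, ← Real.sqrt_eq_rpow, add_zero, one_mul]
  refine h.trans ?_
  rw [mul_add, mul_add, hsqrt]
  rw [hsqrt] at hprod
  refine add_le_add (le_of_eq (by ring)) ?_
  calc divisorTau (1 / 2) δ * (√(((d : ℝ) * q) / ((Nat.totient d : ℝ) * Nat.totient q)) *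
        (8 * K / (1 - θ))) ≤ divisorTau (1 / 2) δ * (Q * P * (8 * K / (1 - θ))) := by gcongr
    _ = Q * (8 * K / (1 - θ)) * (divisorTau (1 / 2) δ * P * 1) := by ring
    _ ≤ _ := by gcongr
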